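/- Setting. Let $a_1=1$, $2(k+1)(4k^2+\tfrac54)a_{k+1}+(2k-1)a_k=0$ for $k\ge 1$, and let $X_0(x)=\tfrac52+\sum_{k\ge1}a_kx^{2k}$ (an entire power series; $X_0'(x)/x$ is analytic on $\mathbb R$ with value $2$ at $x=0$). Put $h(x,y)=2X_0-xX_0'+y^2\,X_0'/x+\sqrt5$, $\;D=\{(x,y)\in\mathbb R^2: x>0\}$, and $S=\{xy(x^2-y^2)=0\}\cup\{(x^2+y^2)X_0'=(2X_0+\sqrt5)x\}$. Consider analytic generic conformally flat hypersurfaces $f_V:V\times I\to\mathbb R^4$, where $V\subset D\setminus S$ is a domain and $I\ni 0$ is an open interval, in principal curvature line coordinates $(x,y,z)$, with unit normal $N$ satisfying $\partial_iN=-\kappa_i\,\partial_if_V$, distinct principal curvatures $\kappa_1,\kappa_2,\kappa_3$, conformally flat first fundamental form $P^2(\cos^2\varphi\,dx^2+\sin^2\varphi\,dy^2+dz^2)$ ($P\ne0$, $\varphi\in(-\pi,\pi)$, $\sin\varphi\cos\varphi\neq0$), and $\kappa_1=P^{-1}\tan\varphi+\kappa_3$, $\kappa_2=-P^{-1}\cot\varphi+\kappa_3$,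 such that at $z=0$ $$\cos\varphi=\tfrac{x^2-y^2}{x^2+y^2},\quad \sin\varphi=\tfrac{2xy}{x^2+y^2},\quad \varphi_z=\tfrac{y}{x^2+y^2},\quad P^{-1}=\tfrac{x\,h(x,y)}{x^2+y^2},$$ $$(P^{-1})_z=\tfrac{(x^2-y^2)(X_0+\sqrt5/2)+2xy^2X_0'}{(x^2+y^2)^2}+\sqrt5,\quad \kappa_3=-\tfrac{y}{x^2+y^2}\bigl(2(X_0-xX_0')+\sqrt5\bigr).$$ A curvature surface on $D$ with frame field $[\phi,X^0_\alpha,X^0_\beta,\xi]$ is an analytic map $f^0:D\to\mathbb R^4$ together with analytic maps $\phi,X^0_\alpha,X^0_\beta,\xi:D\to\mathbb R^4$ which on some domain $V\subset D\setminus S$ are the restrictions to $z=0$ of such a hypersurface $f_V$, of $N$, and of the unit principal directions $(P\cos\varphi)^{-1}\partial_xf_V$, $(P\sin\varphi)^{-1}\partial_yf_V$, $P^{-1}\partial_zf_V$, respectively. Theorem. Let $f^0$ be a curvature surface on $D$ with frame field $[\phi,X^0_\alpha,X^0_\beta,\xi]$. Let $B_2(x)=-\tfrac12X_0'(x)/x-\sqrt5$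 and $C_2(x)=X_0''(x)-X_0'(x)/x$. (1) The vector $\boldsymbol u(y)=(1+y^2)^{-1/2}(yX^0_\beta-\phi)(x,y)$ is a unit vector, does not depend on $x$, and is analytic in $y\in\mathbb R$. (2) The vector $\boldsymbol f(x,y)=((1+y^2)(5+4y^2))^{-1/2}(X^0_\beta-2(1+y^2)\xi+y\phi)(x,y)$ is a unit vector, and there is an analytic $A:\mathbb R\to\mathbb R^4$ with $$f^0(x,y)=\frac1{2\sqrt5}\sqrt{\frac{5+4y^2}{1+y^2}}\;\boldsymbol f(x,y)+A(y)\quad\text{on } D.$$ For each $y$, the $x$-curve $x\mapsto f^0(x,y)$ lies on the round $2$-sphere with centre $A(y)$ and radius $\frac1{2\sqrt5}\sqrt{\frac{5+4y^2}{1+y^2}}$ in the affine hyperplane through $A(y)$ orthogonal to $\boldsymbol u(y)$. (3) $(B_2^2+C_2^2)(x)=\frac{X_0'(x)}{x}\bigl(2X_0-xX_0'-\frac{X_0'}{x}+\sqrt5\bigr)(x)>0$ for all $x\in\mathbb R$. The vector $\tilde{\boldsymbol u}(x)=(B_2^2+C_2^2)^{-1/2}(x)\,(-B_2X^0_\alpha+C_2\xi)(x,y)$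 is a unit vector, does not depend on $y$, and is analytic in $x>0$. (4) The vector $\tilde{\boldsymbol f}(x,y)=(B_2^2+C_2^2)^{-1/2}(x)\,(B_2\xi+C_2X^0_\alpha)(x,y)$ is a unit vector, and there is an analytic $\tilde A:(0,\infty)\to\mathbb R^4$ with $f^0(x,y)=(B_2^2+C_2^2)^{-1/2}(x)\,\tilde{\boldsymbol f}(x,y)+\tilde A(x)$ on $D$. For each $x>0$, the $y$-curve $y\mapsto f^0(x,y)$ lies on the round $2$-sphere with centre $\tilde A(x)$ and radius $(B_2^2+C_2^2)^{-1/2}(x)$ in the affine hyperplane through $\tilde A(x)$ orthogonal to $\tilde{\boldsymbol u}(x)$. Moreover, for a given frame field, $A$ and $\tilde A$ are determined up to a translation: if $g$ is another curvature surface on $D$ with the same frame field, then its functions $A$ and $\tilde A$ differ from those of $f^0$ by constant vectors. -/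

import Mathlib

namespace CurvSurf

noncomputable section

/-- Euclidean `4`-space. -/
abbrev E4 : Type := EuclideanSpace ℝ (Fin 4)

/-! ### The hypergeometric function `X₀` and the initial data on the half plane -/

/-- `coeff k` is the coefficient `a_{k+1}` of `x ^ (2 (k+1))` in `X₀`:
`a_1 = 1` and `2 (k+1) (4 k² + 5/4) a_{k+1} + (2k-1) a_k = 0` for `k ≥ 1`. -/
def coeff : ℕ → ℝ
  | 0 => 1
  | k + 1 => -((2 * (k + 1 : ℝ) - 1) / (2 * (k + 2 : ℝ) * (4 * (k + 1 : ℝ) ^ 2 + 5 / 4))) * coeff k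

/-- `X₀(x) = 5/2 + ∑_{k ≥ 1} a_k x^{2k}`. -/
def X0 (x : ℝ) : ℝ := 5 / 2 + ∑' k : ℕ, coeff k * x ^ (2 * (k + 1))

/-- `X₀'`. -/
def X0d (x : ℝ) : ℝ := deriv X0 x

/-- `X₀''`. -/
def X0dd (x : ℝ) : ℝ := deriv (deriv X0) x

/-- The analytic function `X₀'(x) / x` on `ℝ`, with its value `2` at the origin. -/
def X0q (x : ℝ) : ℝ := if x = 0 then 2 else X0d x / x

/-- `h(x,y) = 2 X₀ - x X₀' + y² (X₀'/x) + √5`. -/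
def hFun (x y : ℝ) : ℝ := 2 * X0 x - x * X0d x + y ^ 2 * X0q x + √5

/-- `P̄`, where `P̄⁻¹ = x h(x,y) / (x² + y²)`. -/
def Pbar (x y : ℝ) : ℝ := (x / (x ^ 2 + y ^ 2) * hFun x y)⁻¹

/-- `(P̄⁻¹)_z`. -/
def PbarInvZ (x y : ℝ) : ℝ :=
  1 / (x ^ 2 + y ^ 2) ^ 2 *
    ((x ^ 2 - y ^ 2) * (X0 x + √5 / 2) + 2 * x * y ^ 2 * X0d x) + √5

/-- `κ̄₃`. -/
def kappaBar3 (x y : ℝ) : ℝ :=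
  -(y / (x ^ 2 + y ^ 2)) * (2 * (X0 x - x * X0d x) + √5)

/-- `B₂(x) = -(1/2) (X₀'/x) - √5`. -/
def B2 (x : ℝ) : ℝ := -(1 / 2) * X0q x - √5

/-- `C₂(x) = X₀'' - X₀'/x`. -/
def C2 (x : ℝ) : ℝ := X0dd x - X0q x

/-- The half plane `D = {x > 0}`. -/
def D : Set (ℝ × ℝ) := {p | 0 < p.1}

/-- The exceptional set `S = S₁ ∪ S₂`: the singular set `S₁` of the metric, and the zero set `S₂`
of the second principal curvature. -/
def S : Set (ℝ × ℝ) :=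
  {p | p.1 * p.2 * (p.1 ^ 2 - p.2 ^ 2) = 0} ∪
  {p | (p.1 ^ 2 + p.2 ^ 2) * X0d p.1 = (2 * X0 p.1 + √5) * p.1}

/-! ### Generic conformally flat hypersurfaces in principal curvature line coordinates -/

/-- The coordinate vectors `∂/∂x`, `∂/∂y`, `∂/∂z` of `ℝ³`. -/
def e : Fin 3 → ℝ × ℝ × ℝ := ![(1, 0, 0), (0, 1, 0), (0, 0, 1)]

/-- The (quadratic form of the) first fundamental form of `f`. -/
def firstFF (f : ℝ × ℝ × ℝ → E4) (p v : ℝ × ℝ × ℝ) : ℝ := ‖fderiv ℝ f p v‖ ^ 2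

/-- The positive definite metric with quadratic form `g p` at `p` is conformally flat on `U`: locally it
is, up to a positive factor, the pull-back of the Euclidean metric by a smooth map into `ℝ³`
(which is then automatically a local diffeomorphism). -/
def IsConformallyFlat (U : Set (ℝ × ℝ × ℝ)) (g : ℝ × ℝ × ℝ → ℝ × ℝ × ℝ → ℝ) : Prop :=
  ∀ p ∈ U, ∃ W : Set (ℝ × ℝ × ℝ), IsOpen W ∧ p ∈ W ∧ W ⊆ U ∧
    ∃ (Ψ : ℝ × ℝ × ℝ → EuclideanSpace ℝ (Fin 3)) (ρ : ℝ × ℝ × ℝ → ℝ),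
      ContDiffOn ℝ (⊤ : ℕ∞) Ψ W ∧
      ∀ q ∈ W, 0 < ρ q ∧ ∀ v, ‖fderiv ℝ Ψ q v‖ ^ 2 = ρ q * g q v

/-- `f` is an analytic generic conformally flat hypersurface of `ℝ⁴` on `U`, in principal curvature
line coordinates, with unit normal field `N` and principal curvatures `κ 0, κ 1, κ 2`
corresponding to the coordinates `x, y, z`. -/
structure IsGenericConformallyFlatHypersurface (U : Set (ℝ × ℝ × ℝ)) (f N : ℝ × ℝ × ℝ → E4)
    (κ : Fin 3 → ℝ × ℝ × ℝ → ℝ) : Prop where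
  analytic : AnalyticOnNhd ℝ f U
  analytic_normal : AnalyticOnNhd ℝ N U
  immersion : ∀ p ∈ U, Function.Injective (fderiv ℝ f p)
  norm_normal : ∀ p ∈ U, ‖N p‖ = 1
  normal_orth : ∀ p ∈ U, ∀ v, inner ℝ (N p) (fderiv ℝ f p v) = 0
  principal : ∀ p ∈ U, ∀ i, fderiv ℝ N p (e i) = -(κ i p) • fderiv ℝ f p (e i)
  generic : ∀ p ∈ U, Function.Injective fun i => κ i p
  conformallyFlat : IsConformallyFlat U (firstFF f)

/-- The functions `φ = ang` and `P` describe the Guichard net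
`g = cos² φ dx² + sin² φ dy² + dz²` of the hypersurface: its first fundamental form is `P² g`, and
`κ₁ = P⁻¹ tan φ + κ₃`, `κ₂ = -P⁻¹ cot φ + κ₃`. (Conformal flatness of `g` is that of `P² g`.) -/
structure HasGuichardNet (U : Set (ℝ × ℝ × ℝ)) (f : ℝ × ℝ × ℝ → E4)
    (κ : Fin 3 → ℝ × ℝ × ℝ → ℝ) (ang P : ℝ × ℝ × ℝ → ℝ) : Prop where
  analytic_ang : AnalyticOnNhd ℝ ang U
  analytic_P : AnalyticOnNhd ℝ P U
  ang_range : ∀ p ∈ U, ang p ∈ Set.Ioo (-Real.pi) Real.pi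
  ang_regular : ∀ p ∈ U, Real.sin (ang p) * Real.cos (ang p) ≠ 0
  P_ne_zero : ∀ p ∈ U, P p ≠ 0
  firstFF_eq : ∀ p ∈ U, ∀ v : ℝ × ℝ × ℝ, firstFF f p v =
    P p ^ 2 * (Real.cos (ang p) ^ 2 * v.1 ^ 2 + Real.sin (ang p) ^ 2 * v.2.1 ^ 2 + v.2.2 ^ 2)
  kappa1 : ∀ p ∈ U, κ 0 p = (P p)⁻¹ * (Real.sin (ang p) / Real.cos (ang p)) + κ 2 p
  kappa2 : ∀ p ∈ U, κ 1 p = -((P p)⁻¹ * (Real.cos (ang p) / Real.sin (ang p))) + κ 2 p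

/-- The Guichard net and the principal curvatures have the prescribed values on `V × {0}`:
`cos φ = (x²-y²)/(x²+y²)`, `sin φ = 2xy/(x²+y²)`, `φ_z = y/(x²+y²)`, `P = P̄`,
`(P⁻¹)_z = (P̄⁻¹)_z`, `κ₃ = κ̄₃`. -/
structure HasInitialData (V : Set (ℝ × ℝ)) (κ : Fin 3 → ℝ × ℝ × ℝ → ℝ)
    (ang P : ℝ × ℝ × ℝ → ℝ) : Prop where
  cos_ang : ∀ x y, (x, y) ∈ V → Real.cos (ang (x, y, 0)) = (x ^ 2 - y ^ 2) / (x ^ 2 + y ^ 2)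
  sin_ang : ∀ x y, (x, y) ∈ V → Real.sin (ang (x, y, 0)) = 2 * x * y / (x ^ 2 + y ^ 2)
  ang_z : ∀ x y, (x, y) ∈ V → fderiv ℝ ang (x, y, 0) (e 2) = y / (x ^ 2 + y ^ 2)
  P_eq : ∀ x y, (x, y) ∈ V → P (x, y, 0) = Pbar x y
  P_inv_z : ∀ x y, (x, y) ∈ V →
    fderiv ℝ (fun q => (P q)⁻¹) (x, y, 0) (e 2) = PbarInvZ x y
  kappa3 : ∀ x y, (x, y) ∈ V → κ 2 (x, y, 0) = kappaBar3 x y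

/-- `f` is a curvature surface on `D` with frame field `[φ, Xα, Xβ, ξ]`: all of them are analytic on
`D`, and over some domain `V ⊆ D \ S` they are the restrictions to `z = 0` of a generic
conformally flat hypersurface `F` on `V × (-ε, ε)` with the prescribed data, of its unit normal,
and of its unit principal directions. -/
structure IsCurvatureSurface (f φ Xα Xβ ξ : ℝ × ℝ → E4) : Prop where
  analytic : AnalyticOnNhd ℝ f D
  analytic_φ : AnalyticOnNhd ℝ φ D
  analytic_Xα : AnalyticOnNhd ℝ Xα D
  analytic_Xβ : AnalyticOnNhd ℝ Xβ D
  analytic_ξ : AnalyticOnNhd ℝ ξ D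
  hypersurface : ∃ (V : Set (ℝ × ℝ)) (ε : ℝ) (F N : ℝ × ℝ × ℝ → E4)
      (κ : Fin 3 → ℝ × ℝ × ℝ → ℝ) (ang P : ℝ × ℝ × ℝ → ℝ),
    IsOpen V ∧ IsConnected V ∧ V ⊆ D \ S ∧ 0 < ε ∧
    IsGenericConformallyFlatHypersurface {q | (q.1, q.2.1) ∈ V ∧ q.2.2 ∈ Set.Ioo (-ε) ε} F N κ ∧
    HasGuichardNet {q | (q.1, q.2.1) ∈ V ∧ q.2.2 ∈ Set.Ioo (-ε) ε} F κ ang P ∧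
    HasInitialData V κ ang P ∧
    ∀ x y, (x, y) ∈ V →
      f (x, y) = F (x, y, 0) ∧
      φ (x, y) = N (x, y, 0) ∧
      Xα (x, y) =
        (P (x, y, 0) * Real.cos (ang (x, y, 0)))⁻¹ • fderiv ℝ F (x, y, 0) (e 0) ∧
      Xβ (x, y) =
        (P (x, y, 0) * Real.sin (ang (x, y, 0)))⁻¹ • fderiv ℝ F (x, y, 0) (e 1) ∧
      ξ (x, y) = (P (x, y, 0))⁻¹ • fderiv ℝ F (x, y, 0) (e 2)

/-! ### Spheres and the vectors of the statement -/

/-- The round `2`-sphere with centre `c` and radius `r` in the affine hyperplane through `c`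
orthogonal to `n`. -/
def sphereIn (n c : E4) (r : ℝ) : Set E4 :=
  Metric.sphere c r ∩ {p | inner ℝ n (p - c) = 0}

/-- The radius `(2√5)⁻¹ √((5+4y²)/(1+y²))`. -/
def radX (y : ℝ) : ℝ := (2 * √5)⁻¹ * √((5 + 4 * y ^ 2) / (1 + y ^ 2))

/-- The radius `(B₂² + C₂²)^{-1/2}`. -/
def radY (x : ℝ) : ℝ := (√(B2 x ^ 2 + C2 x ^ 2))⁻¹

/-- `((1+y²)(5+4y²))^{-1/2} (Xβ - 2(1+y²) ξ + y φ)`. -/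
def vecX (φ Xβ ξ : ℝ × ℝ → E4) (x y : ℝ) : E4 :=
  (√((1 + y ^ 2) * (5 + 4 * y ^ 2)))⁻¹ •
    (Xβ (x, y) - (2 * (1 + y ^ 2)) • ξ (x, y) + y • φ (x, y))

/-- `(B₂² + C₂²)^{-1/2} (B₂ ξ + C₂ Xα)`. -/
def vecY (Xα ξ : ℝ × ℝ → E4) (x y : ℝ) : E4 :=
  (√(B2 x ^ 2 + C2 x ^ 2))⁻¹ • (B2 x • ξ (x, y) + C2 x • Xα (x, y))

end

end CurvSurf

open Filter Topology Set

namespace CurvSurf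

/-! In orthogonal coordinates with Lamé coefficients `H i`, each normalized coordinate field `X_i`
satisfies `∂_j X_i = (∂_i H_j / H_i) X_j` for `j ≠ i`: its derivative along another coordinate is a
multiple of one frame vector. At `z = 0` the initial data determine these multiples. So along an
`x`-curve the derivatives of `f`, `φ`, `Xβ`, `ξ` are all multiples of `Xα`, and along a `y`-curve
those of `f`, `Xα`, `ξ` are all multiples of `Xβ` (`frameEquationsAt_of_hypersurface`).

The multiples are proportional enough for linear combinations to close up. With `T = 2 X₀ + √5`, the
`x`-derivatives of `φ` and `Xβ` have factors `-yT/(xh)` and `-T/(xh)`, so `y Xβ - φ` is constant in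
`x`. In `Xβ - 2(1+y²) ξ + y φ` the terms with `T` cancel, leaving `2√5 (1+y²) ∂ₓf`. Along `y` the
derivatives of `Xα`, `ξ`, `f` are in the ratio `C₂ : B₂ : 1`, so `-B₂ Xα + C₂ ξ` is constant in `y`,
and `B₂ ξ + C₂ Xα` has derivative `(B₂² + C₂²) ∂_y f`. Subtracting the suitably scaled vectors from
`f` gives the centres; norms and orthogonality follow from orthonormality of the frame.

Two global facts are needed. Writing `X₀(x) = G0 (x²)`, the recursion becomes a linear third order
equation with a quadratic first integral (`G_firstIntegral`). It gives the formula for `B₂² + C₂²`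
and the positivity of `h`, so the frame equations have analytic coefficients on all of `D`. The
identity theorem then carries them from `V` to `D` (`IsCurvatureSurface.frameEquationsAt`), across
the singular set. -/

/-! ### Entire power series -/

/-- The sum of the power series with coefficients `c`. -/
noncomputable def pser (c : ℕ → ℝ) (t : ℝ) : ℝ := ∑' k, c k * t ^ k

/-- The coefficients of the derived power series. -/
def dcoeff (c : ℕ → ℝ) (k : ℕ) : ℝ := (k + 1) * c (k + 1)

/-- The power series with coefficients `c` converges everywhere. -/
def IsEntireSeries (c : ℕ → ℝ) : Prop := ∀ r : ℝ, 0 < r → Summable fun k => |c k| * r ^ k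

theorem IsEntireSeries.summable {c : ℕ → ℝ} (hc : IsEntireSeries c) (t : ℝ) :
    Summable fun k => c k * t ^ k := by
  refine .of_norm_bounded (hc (|t| + 1) (by positivity)) fun k => ?_
  rw [norm_mul, norm_pow, Real.norm_eq_abs, Real.norm_eq_abs]
  gcongr
  linarith

theorem IsEntireSeries.hasSum {c : ℕ → ℝ} (hc : IsEntireSeries c) (t : ℝ) :
    HasSum (fun k => c k * t ^ k) (pser c t) := (hc.summable t).hasSum

/-- Since `k ≤ 2 ^ k`, the factor `k` is absorbed by doubling the radius. -/
theorem IsEntireSeries.natCast_mul {c : ℕ → ℝ} (hc : IsEntireSeries c) :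
    IsEntireSeries fun k => k * c k := by
  intro r hr
  refine .of_nonneg_of_le (fun k => by positivity) (fun k => ?_) (hc (2 * r) (by positivity))
  have : (k : ℝ) ≤ 2 ^ k := by exact_mod_cast (Nat.lt_two_pow_self).le
  rw [abs_mul, Nat.abs_cast, mul_pow]
  calc (k : ℝ) * |c k| * r ^ k ≤ 2 ^ k * |c k| * r ^ k := by gcongr
    _ = _ := by ring

theorem IsEntireSeries.dcoeff {c : ℕ → ℝ} (hc : IsEntireSeries c) :
    IsEntireSeries (dcoeff c) := by
  intro r hr
  have h := ((summable_nat_add_iff 1).2 (hc.natCast_mul r hr)).mul_left r⁻¹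
  refine h.congr fun k => ?_
  simp only [CurvSurf.dcoeff, pow_succ, Nat.cast_add, Nat.cast_one]
  field_simp

theorem IsEntireSeries.hasDerivAt {c : ℕ → ℝ} (hc : IsEntireSeries c) (t : ℝ) :
    HasDerivAt (pser c) (pser (CurvSurf.dcoeff c) t) t := by
  set r := |t| + 1 with hr
  have hr0 : 0 < r := by positivity
  have key := hasDerivAt_tsum_of_isPreconnected (𝕜 := ℝ)
    (u := fun k => r⁻¹ * (|k * c k| * r ^ k))
    (g := fun k s => c k * s ^ k) (g' := fun k s => c k * (k * s ^ (k - 1)))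
    (t := Metric.ball 0 r) (y₀ := 0) (y := t)
    ((hc.natCast_mul r hr0).mul_left _) Metric.isOpen_ball
    (convex_ball _ _).isPreconnected
    (fun k s _ => (hasDerivAt_pow k s).const_mul _)
    (fun k s hs => ?_) (by simpa using hr0) (hc.summable 0) (by simp [hr])
  · have e : ∑' k, c k * (k * t ^ (k - 1)) = pser (CurvSurf.dcoeff c) t := by
      -- The term `k = 0` vanishes because of its factor `k`; the others, shifted by one, form the
      -- derived series.
      rw [tsum_eq_zero_add']
      · simp only [pser, CurvSurf.dcoeff]
        simp
        exact tsum_congr fun k => by ring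
      · refine (hc.dcoeff.summable t).congr fun k => ?_
        simp only [CurvSurf.dcoeff]
        simp
        ring
    rw [e] at key
    exact key
  · rcases k with _ | k
    · simp
    · have hs' : |s| ≤ r := by simpa using (mem_ball_zero_iff.1 hs).le
      rw [norm_mul, norm_mul, norm_pow, Real.norm_eq_abs, Real.norm_eq_abs, Real.norm_eq_abs,
        Nat.add_sub_cancel, abs_mul, pow_succ]
      calc |c (k + 1)| * (|((k + 1 : ℕ) : ℝ)| * |s| ^ k)
          ≤ |c (k + 1)| * (|((k + 1 : ℕ) : ℝ)| * r ^ k) := by gcongr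
        _ = _ := by field_simp

theorem IsEntireSeries.analyticAt {c : ℕ → ℝ} (hc : IsEntireSeries c) (t : ℝ) :
    AnalyticAt ℝ (pser c) t := by
  set p := FormalMultilinearSeries.ofScalars ℝ c with hp
  have hrad : p.radius = ⊤ := by
    refine ENNReal.eq_top_of_forall_nnreal_le fun r => ?_
    refine p.le_radius_of_summable ?_
    refine .of_nonneg_of_le (fun k => by positivity) (fun k => ?_) (hc (r + 1) (by positivity))
    rw [hp, FormalMultilinearSeries.ofScalars_norm, Real.norm_eq_abs]
    gcongr
    simp
  have h := p.hasFPowerSeriesOnBall (by rw [hrad]; exact ENNReal.zero_lt_top)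
  have e : p.sum = pser c := by
    funext s
    simp only [FormalMultilinearSeries.sum, pser, hp, FormalMultilinearSeries.ofScalars_apply_eq]
    exact tsum_congr fun k => by simp
  rw [e, hrad] at h
  exact h.analyticOnNhd t (by simp)

/-- The Euler operator `t d/dt` multiplies the `k`-th coefficient by `k`; this turns the recursion
into a differential equation. -/
theorem IsEntireSeries.mul_pser_dcoeff {c : ℕ → ℝ} (hc : IsEntireSeries c) (t : ℝ) :
    t * pser (CurvSurf.dcoeff c) t = pser (fun k => k * c k) t := by
  have h : HasSum (fun k : ℕ => ((k + 1 : ℕ) : ℝ) * c (k + 1) * t ^ (k + 1))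
      (t * pser (CurvSurf.dcoeff c) t) := by
    refine ((hc.dcoeff.hasSum t).mul_left t).congr_fun ?_
    intro k
    simp only [CurvSurf.dcoeff]; push_cast; ring
  have h2 : HasSum (fun k : ℕ => (k : ℝ) * c k * t ^ k) (t * pser (CurvSurf.dcoeff c) t) :=
    (hasSum_nat_add_iff' 1).1 (by simpa using h)
  exact h2.tsum_eq.symm

/-! ### The function `X₀` -/

/-- The coefficients of `X₀` as a power series in `x²`. -/
noncomputable def coeffX : ℕ → ℝ
  | 0 => 5 / 2
  | k + 1 => coeff k

/-- Taking `5/2` as `a_0` makes the recursion hold at `k = 0` too. -/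
theorem coeffX_rec (k : ℕ) :
    8 * (k * (k * dcoeff coeffX k)) + 5 / 2 * dcoeff coeffX k + 2 * (k * coeffX k) - coeffX k
      = 0 := by
  rcases k with _ | k
  · simp [dcoeff, coeffX, coeff]
  · have : (4 * ((k : ℝ) + 1) ^ 2 + 5 / 4) ≠ 0 := by positivity
    simp only [dcoeff, coeffX, coeff]
    push_cast
    field_simp
    ring

theorem abs_coeff_le (k : ℕ) : |coeff k| ≤ ((Nat.factorial k : ℕ) : ℝ)⁻¹ := by
  induction k with
  | zero => simp [coeff]
  | succ k ih =>
    rw [coeff, abs_mul, abs_neg, Nat.factorial_succ, Nat.cast_mul, mul_inv, abs_of_nonneg]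
    · gcongr
      rw [inv_eq_one_div, div_le_div_iff₀ (by positivity) (by positivity)]
      push_cast
      nlinarith [show (0 : ℝ) ≤ k by positivity, show (0 : ℝ) ≤ (k : ℝ) ^ 3 by positivity,
        show (0 : ℝ) ≤ (k : ℝ) ^ 2 by positivity]
    · have : (0 : ℝ) ≤ 2 * (k + 1 : ℝ) - 1 := by linarith [show (0 : ℝ) ≤ k by positivity]
      positivity

theorem isEntireSeries_coeffX : IsEntireSeries coeffX := by
  intro r hr
  rw [← summable_nat_add_iff 1]
  refine .of_nonneg_of_le (fun k => by positivity) (fun k => ?_)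
    ((Real.summable_pow_div_factorial r).mul_left r)
  rw [coeffX, pow_succ, div_eq_mul_inv]
  calc |coeff k| * (r ^ k * r) ≤ ((Nat.factorial k : ℕ) : ℝ)⁻¹ * (r ^ k * r) := by
        gcongr; exact abs_coeff_le k
    _ = _ := by ring

/-- `X₀(x) = G0 (x²)`. -/
noncomputable def G0 : ℝ → ℝ := pser coeffX

/-- The derivative of `G0`. -/
noncomputable def G1 : ℝ → ℝ := pser (dcoeff coeffX)

/-- The second derivative of `G0`. -/
noncomputable def G2 : ℝ → ℝ := pser (dcoeff (dcoeff coeffX))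

/-- The third derivative of `G0`. -/
noncomputable def G3 : ℝ → ℝ := pser (dcoeff (dcoeff (dcoeff coeffX)))

theorem hasDerivAt_G0 (t : ℝ) : HasDerivAt G0 (G1 t) t := isEntireSeries_coeffX.hasDerivAt t

theorem hasDerivAt_G1 (t : ℝ) : HasDerivAt G1 (G2 t) t :=
  isEntireSeries_coeffX.dcoeff.hasDerivAt t

theorem hasDerivAt_G2 (t : ℝ) : HasDerivAt G2 (G3 t) t :=
  isEntireSeries_coeffX.dcoeff.dcoeff.hasDerivAt t

theorem G0_zero : G0 0 = 5 / 2 := by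
  rw [G0, pser, tsum_eq_single 0 (by intro k hk; simp [hk])]
  simp [coeffX]

theorem G1_zero : G1 0 = 1 := by
  rw [G1, pser, tsum_eq_single 0 (by intro k hk; simp [hk])]
  simp [dcoeff, coeffX, coeff]

/-- This is `coeffX_rec` summed against `t ^ k`: the factor `k²` is the Euler operator applied twice
to `G1`, which gives `t (G2 + t G3)`. -/
theorem G_ode (t : ℝ) :
    8 * (t * G2 t + t ^ 2 * G3 t) + 5 / 2 * G1 t + 2 * (t * G1 t) - G0 t = 0 := by
  have h0 := isEntireSeries_coeffX
  have h1 := h0.dcoeff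
  have e2 : (fun s => s * G2 s) = pser (fun k => k * dcoeff coeffX k) :=
    funext fun s => h1.mul_pser_dcoeff s
  have d := h1.natCast_mul.hasDerivAt t
  rw [← e2] at d
  have d' := ((hasDerivAt_id' t).mul (hasDerivAt_G2 t)).unique d
  have e3 := h1.natCast_mul.mul_pser_dcoeff t
  rw [← d'] at e3
  have s := ((((h1.natCast_mul.natCast_mul.hasSum t).mul_left 8).add
    ((h1.hasSum t).mul_left (5 / 2))).add ((h0.natCast_mul.hasSum t).mul_left 2)).sub (h0.hasSum t)
  rw [← e3, ← h0.mul_pser_dcoeff t] at s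
  have z : HasSum (fun _ : ℕ => (0 : ℝ)) 0 := hasSum_zero
  have := s.unique (z.congr_fun fun k => by linear_combination t ^ k * coeffX_rec k)
  simp only [G0, G1, G2, G3] at this ⊢
  linear_combination this

/-- The derivative of the left side is `4 G2` times the left side of `G_ode`, and the value at `0`
is `5 - 10 + 5`. -/
theorem G_firstIntegral (t : ℝ) :
    16 * t ^ 2 * G2 t ^ 2 + 5 - 4 * G0 t * G1 t + 4 * (t + 5 / 4) * G1 t ^ 2 = 0 := by
  have hd : ∀ s, HasDerivAt (fun t => 16 * t ^ 2 * G2 t ^ 2 + 5 - 4 * G0 t * G1 t +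
      4 * (t + 5 / 4) * G1 t ^ 2) 0 s := by
    intro s
    have := (((((hasDerivAt_id' s).pow 2).const_mul 16).mul ((hasDerivAt_G2 s).pow 2)).add_const
      5).sub (((hasDerivAt_G0 s).const_mul 4).mul (hasDerivAt_G1 s)) |>.add
      ((((hasDerivAt_id' s).add_const (5 / 4)).const_mul 4).mul ((hasDerivAt_G1 s).pow 2))
    refine this.congr_deriv ?_
    simp only [Pi.pow_apply]
    push_cast
    linear_combination 4 * G2 s * G_ode s
  have := is_const_of_deriv_eq_zero (fun s => (hd s).differentiableAt) (fun s => (hd s).deriv) t 0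
  rw [this, G0_zero, G1_zero]
  norm_num

/-- At a zero of `G1` the first integral would read `16 t² G2² + 5 = 0`; since `G1 0 = 1`, the sign
cannot change. -/
theorem G1_pos (t : ℝ) (ht : 0 ≤ t) : 0 < G1 t := by
  have hc : Continuous G1 := continuous_iff_continuousAt.2 fun s => (hasDerivAt_G1 s).continuousAt
  by_contra! hle
  have : (0 : ℝ) ∈ G1 '' Set.Icc 0 t :=
    intermediate_value_Icc' ht hc.continuousOn ⟨hle, by rw [G1_zero]; norm_num⟩
  obtain ⟨s, -, hs⟩ := this
  have := G_firstIntegral s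
  rw [hs] at this
  nlinarith [sq_nonneg (s * G2 s)]

theorem G0_sub_pos (t : ℝ) (ht : 0 ≤ t) : 0 < G0 t - (t + 5 / 4) * G1 t := by
  have h1 := G1_pos t ht
  have h := G_firstIntegral t
  have : 0 < 4 * G1 t * (G0 t - (t + 5 / 4) * G1 t) := by nlinarith [sq_nonneg (t * G2 t)]
  exact pos_of_mul_pos_right this (by positivity)

theorem X0_eq (x : ℝ) : X0 x = G0 (x ^ 2) := by
  rw [X0, G0, pser, (isEntireSeries_coeffX.summable _).tsum_eq_zero_add]
  simp [coeffX, pow_mul]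

theorem hasDerivAt_X0 (x : ℝ) : HasDerivAt X0 (2 * x * G1 (x ^ 2)) x := by
  have := (hasDerivAt_G0 (x ^ 2)).comp x (hasDerivAt_pow 2 x)
  rw [show X0 = G0 ∘ fun x => x ^ 2 from funext X0_eq]
  exact this.congr_deriv (by push_cast; ring)

theorem X0d_eq (x : ℝ) : X0d x = 2 * x * G1 (x ^ 2) := (hasDerivAt_X0 x).deriv

theorem X0q_eq (x : ℝ) : X0q x = 2 * G1 (x ^ 2) := by
  by_cases hx : x = 0
  · simp [X0q, hx, G1_zero]
  · rw [X0q, if_neg hx, X0d_eq]; field_simp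

theorem X0dd_eq (x : ℝ) : X0dd x = 2 * G1 (x ^ 2) + 4 * x ^ 2 * G2 (x ^ 2) := by
  have e : deriv X0 = fun x => 2 * x * G1 (x ^ 2) := funext X0d_eq
  rw [X0dd, e]
  have := ((hasDerivAt_id' x).const_mul 2).mul ((hasDerivAt_G1 (x ^ 2)).comp x (hasDerivAt_pow 2 x))
  refine (this.congr_deriv ?_).deriv
  simp only [Function.comp]
  push_cast; ring

theorem C2_eq (x : ℝ) : C2 x = 4 * x ^ 2 * G2 (x ^ 2) := by
  rw [C2, X0dd_eq, X0q_eq]; ring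

theorem hFun_eq (x y : ℝ) :
    hFun x y = 2 * G0 (x ^ 2) - 2 * (x ^ 2 - y ^ 2) * G1 (x ^ 2) + √5 := by
  rw [hFun, X0_eq, X0d_eq, X0q_eq]; ring

/-- `h = 2 (G0 - (t + 5/4) G1) + (5/2 + 2y²) G1 + √5` with `t = x²`, a sum of positive and
nonnegative terms. -/
theorem hFun_pos (x y : ℝ) : 0 < hFun x y := by
  rw [hFun_eq]
  have h1 := G1_pos (x ^ 2) (by positivity)
  have h2 := G0_sub_pos (x ^ 2) (by positivity)
  nlinarith [Real.sqrt_nonneg 5, mul_nonneg (sq_nonneg y) h1.le]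

theorem B2_sq_add_C2_sq (x : ℝ) :
    B2 x ^ 2 + C2 x ^ 2 = X0q x * (2 * X0 x - x * X0d x - X0q x + √5) := by
  rw [B2, C2_eq, X0q_eq, X0_eq, X0d_eq]
  linear_combination G_firstIntegral (x ^ 2) + Real.sq_sqrt (show (0 : ℝ) ≤ 5 by norm_num)

theorem B2_sq_add_C2_sq_pos (x : ℝ) : 0 < B2 x ^ 2 + C2 x ^ 2 := by
  -- Positivity needs only that `B₂` never vanishes.
  have : B2 x < 0 := by
    rw [B2, X0q_eq]
    linarith [G1_pos (x ^ 2) (by positivity), Real.sqrt_nonneg 5]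
  nlinarith [sq_nonneg (C2 x)]

/-- Here `⊤` is the analytic smoothness class, so analyticity can be read off later. -/
theorem contDiff_X0 : ContDiff ℝ ⊤ X0 := by
  rw [contDiff_iff_contDiffAt]
  intro x
  rw [show X0 = G0 ∘ fun x => x ^ 2 from funext X0_eq]
  exact (isEntireSeries_coeffX.analyticAt _).contDiffAt.comp x (by fun_prop)

theorem contDiff_X0q : ContDiff ℝ ⊤ X0q := by
  rw [contDiff_iff_contDiffAt]
  intro x
  rw [show X0q = fun x => 2 * (G1 ∘ fun x => x ^ 2) x from funext X0q_eq]
  exact contDiffAt_const.mul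
    ((isEntireSeries_coeffX.dcoeff.analyticAt _).contDiffAt.comp x (by fun_prop))

theorem contDiff_C2 : ContDiff ℝ ⊤ C2 := by
  rw [contDiff_iff_contDiffAt]
  intro x
  rw [show C2 = fun x => 4 * x ^ 2 * (G2 ∘ fun x => x ^ 2) x from funext C2_eq]
  exact ContDiffAt.mul (by fun_prop)
    ((isEntireSeries_coeffX.dcoeff.dcoeff.analyticAt _).contDiffAt.comp x (by fun_prop))

theorem contDiff_B2 : ContDiff ℝ ⊤ B2 := by
  have := contDiff_X0q
  unfold B2
  fun_prop

/-! ### Orthogonal coordinate systems with a normal field -/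

theorem eq_zero_of_inner_orthogonal_eq_zero {v : Fin 4 → E4} (hv : ∀ i, v i ≠ 0)
    (ho : ∀ i j, i ≠ j → inner ℝ (v i) (v j) = 0) {w : E4} (hw : ∀ i, inner ℝ (v i) w = 0) :
    w = 0 := by
  have hli : LinearIndependent ℝ v := linearIndependent_of_ne_zero_of_inner_eq_zero hv ho
  have hspan : Submodule.span ℝ (Set.range v) = ⊤ :=
    hli.span_eq_top_of_card_eq_finrank' (by simp)
  have hmem : w ∈ (Submodule.span ℝ (Set.range v))ᗮ := by
    rw [Submodule.mem_orthogonal]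
    intro u hu
    induction hu using Submodule.span_induction with
    | mem x hx => obtain ⟨i, rfl⟩ := hx; exact hw i
    | zero => simp
    | add x y _ _ hx hy => rw [inner_add_left, hx, hy, add_zero]
    | smul a x _ hx => rw [inner_smul_left, hx, mul_zero]
  simpa [hspan] using hmem

/-- The partial derivative `∂_i F`. -/
noncomputable def pd {X : Type*} [NormedAddCommGroup X] [NormedSpace ℝ X]
    (F : ℝ × ℝ × ℝ → X) (i : Fin 3) (p : ℝ × ℝ × ℝ) : X := fderiv ℝ F p (e i)

theorem analyticAt_pd {X : Type*} [NormedAddCommGroup X] [NormedSpace ℝ X] [CompleteSpace X]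
    {F : ℝ × ℝ × ℝ → X} {p : ℝ × ℝ × ℝ} (h : AnalyticAt ℝ F p) (i : Fin 3) :
    AnalyticAt ℝ (pd F i) p :=
  ((ContinuousLinearMap.apply ℝ X (e i)).analyticAt _).comp h.fderiv

theorem pd_pd_comm {X : Type*} [NormedAddCommGroup X] [NormedSpace ℝ X] [CompleteSpace X]
    {F : ℝ × ℝ × ℝ → X} {p : ℝ × ℝ × ℝ} (h : AnalyticAt ℝ F p) (i j : Fin 3) :
    pd (pd F i) j p = pd (pd F j) i p := by
  have hs : IsSymmSndFDerivAt ℝ F p := h.contDiffAt.isSymmSndFDerivAt_of_omega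
  have key : ∀ i j, pd (pd F i) j p = fderiv ℝ (fderiv ℝ F) p (e j) (e i) := by
    intro i j
    have h1 : DifferentiableAt ℝ (fderiv ℝ F) p := h.fderiv.differentiableAt
    have := ((ContinuousLinearMap.apply ℝ X (e i)).hasFDerivAt (x := fderiv ℝ F p)).comp p
      h1.hasFDerivAt
    rw [pd, show pd F i = (ContinuousLinearMap.apply ℝ X (e i)) ∘ fderiv ℝ F from rfl,
      this.fderiv]
    rfl
  rw [key, key, hs.eq]

theorem pd_inner {F G : ℝ × ℝ × ℝ → E4} {p : ℝ × ℝ × ℝ} (hF : DifferentiableAt ℝ F p)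
    (hG : DifferentiableAt ℝ G p) (i : Fin 3) :
    pd (fun q => inner ℝ (F q) (G q)) i p
      = inner ℝ (F p) (pd G i p) + inner ℝ (pd F i p) (G p) :=
  fderiv_inner_apply ℝ hF hG (e i)

theorem pd_congr {X : Type*} [NormedAddCommGroup X] [NormedSpace ℝ X]
    {F G : ℝ × ℝ × ℝ → X} {U : Set (ℝ × ℝ × ℝ)} (hU : IsOpen U) {p : ℝ × ℝ × ℝ} (hp : p ∈ U)
    (h : ∀ q ∈ U, F q = G q) (i : Fin 3) : pd F i p = pd G i p := by
  rw [pd, pd, Filter.EventuallyEq.fderiv_eq (Filter.eventuallyEq_of_mem (hU.mem_nhds hp) h)]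

theorem pd_pd_of_orthogonal {U : Set (ℝ × ℝ × ℝ)} (hU : IsOpen U) {F N : ℝ × ℝ × ℝ → E4}
    {H κ : Fin 3 → ℝ × ℝ × ℝ → ℝ} (hF : AnalyticOnNhd ℝ F U) (hN : AnalyticOnNhd ℝ N U)
    (hN1 : ∀ p ∈ U, ‖N p‖ = 1) (hNF : ∀ p ∈ U, ∀ i, inner ℝ (N p) (pd F i p) = 0)
    (hκ : ∀ p ∈ U, ∀ i, pd N i p = -(κ i p) • pd F i p)
    (hH : ∀ i, ∀ p ∈ U, DifferentiableAt ℝ (H i) p) (hH0 : ∀ i, ∀ p ∈ U, H i p ≠ 0)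
    (hd : ∀ i, ∀ p ∈ U, inner ℝ (pd F i p) (pd F i p) = H i p ^ 2)
    (ho : ∀ i j, i ≠ j → ∀ p ∈ U, inner ℝ (pd F i p) (pd F j p) = 0)
    {p : ℝ × ℝ × ℝ} (hp : p ∈ U) {i j : Fin 3} (hij : i ≠ j) :
    pd (pd F i) j p = (pd (H i) j p / H i p) • pd F i p + (pd (H j) i p / H j p) • pd F j p := by
  have hdiff : ∀ i, DifferentiableAt ℝ (pd F i) p := fun i =>
    (analyticAt_pd (hF p hp) i).differentiableAt
  have hpo : ∀ i j, i ≠ j → ∀ k,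
      inner ℝ (pd F i p) (pd (pd F j) k p) + inner ℝ (pd (pd F i) k p) (pd F j p) = 0 := by
    intro i j hij k
    rw [← pd_inner (hdiff i) (hdiff j), pd_congr hU hp (ho i j hij)]
    simp [pd]
  have hpd : ∀ i k, inner ℝ (pd F i p) (pd (pd F i) k p) = H i p * pd (H i) k p := by
    intro i k
    have h1 := pd_inner (hdiff i) (hdiff i) k
    rw [pd_congr hU hp (hd i)] at h1
    have h2 : pd (fun q => H i q ^ 2) k p = 2 * (H i p * pd (H i) k p) := by
      rw [pd, ((hH i p hp).hasFDerivAt.pow 2).fderiv]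
      simp [pd]; ring
    have h3 := real_inner_comm (pd F i p) (pd (pd F i) k p)
    linarith
  -- Differentiating `⟨N, ∂_i F⟩ = 0` leaves `⟨∂_j N, ∂_i F⟩`, which vanishes because `∂_j N` is
  -- parallel to `∂_j F`.
  have hpN : ∀ i j, i ≠ j → inner ℝ (N p) (pd (pd F i) j p) = 0 := by
    intro i j hij
    have h1 := pd_inner (hN p hp).differentiableAt (hdiff i) j
    rw [pd_congr hU hp (fun q hq => hNF q hq i), hκ p hp, inner_smul_left,
      ho j i hij.symm p hp] at h1
    simpa [pd] using h1.symm
  have hzero : ∀ k, i ≠ k → j ≠ k → inner ℝ (pd F k p) (pd (pd F i) j p) = 0 := by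
    intro k hik hjk
    have a1 := hpo i k hik j
    have a2 := hpo i j hij k
    have a3 := hpo k j hjk.symm i
    rw [pd_pd_comm (hF p hp) k j] at a1
    rw [pd_pd_comm (hF p hp) i k] at a2
    rw [pd_pd_comm (hF p hp) j i] at a3
    rw [real_inner_comm (pd F k p)] at a1
    linarith
  have hsub : ∀ k, inner ℝ (pd F k p) (pd (pd F i) j p) =
      inner ℝ (pd F k p)
        ((pd (H i) j p / H i p) • pd F i p + (pd (H j) i p / H j p) • pd F j p) := by
    intro k
    rw [inner_add_right, inner_smul_right, inner_smul_right]
    by_cases hki : k = i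
    · subst hki
      rw [hpd, hd k p hp, ho k j hij p hp]
      field_simp [hH0 k p hp]
      ring
    by_cases hkj : k = j
    · subst hkj
      rw [pd_pd_comm (hF p hp) i k, hpd, hd k p hp, ho k i hij.symm p hp]
      field_simp [hH0 k p hp]
      ring
    · rw [hzero k (Ne.symm hki) (Ne.symm hkj), ho k i hki p hp, ho k j hkj p hp]
      ring
  have hne : ∀ k, pd F k p ≠ 0 := by
    intro k h0
    have := hd k p hp
    rw [h0, inner_zero_left] at this
    exact pow_ne_zero 2 (hH0 k p hp) this.symm
  rw [← sub_eq_zero]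
  -- The three coordinate vectors and the normal form an orthogonal basis, so it suffices to compare
  -- inner products with these.
  refine eq_zero_of_inner_orthogonal_eq_zero (v := ![pd F 0 p, pd F 1 p, pd F 2 p, N p]) ?_ ?_ ?_
  · have : N p ≠ 0 := by
      intro h0; simpa [h0] using hN1 p hp
    intro k; fin_cases k <;> simp [hne, this]
  · intro k l hkl
    have hNF' : ∀ k, inner ℝ (pd F k p) (N p) = 0 := fun k => by
      rw [real_inner_comm]; exact hNF p hp k
    fin_cases k <;> fin_cases l <;>
      first
        | exact absurd rfl hkl
        | simp [hNF', hNF p hp, ho 0 1 (by decide) p hp, ho 1 0 (by decide) p hp,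
            ho 0 2 (by decide) p hp, ho 2 0 (by decide) p hp, ho 1 2 (by decide) p hp,
            ho 2 1 (by decide) p hp]
  · have hNsub : inner ℝ (N p) (pd (pd F i) j p -
        ((pd (H i) j p / H i p) • pd F i p + (pd (H j) i p / H j p) • pd F j p)) = 0 := by
      rw [inner_sub_right, inner_add_right, inner_smul_right, inner_smul_right, hpN i j hij,
        hNF p hp, hNF p hp]
      ring
    intro k
    fin_cases k
    · exact (inner_sub_right _ _ _).trans (sub_eq_zero.2 (hsub 0))
    · exact (inner_sub_right _ _ _).trans (sub_eq_zero.2 (hsub 1))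
    · exact (inner_sub_right _ _ _).trans (sub_eq_zero.2 (hsub 2))
    · exact hNsub

/-- The equations `∂_j X_i = (∂_i H_j / H_i) X_j` for the normalized coordinate fields `X_i`. -/
theorem pd_normalized_of_orthogonal {U : Set (ℝ × ℝ × ℝ)} {F : ℝ × ℝ × ℝ → E4}
    {H : Fin 3 → ℝ × ℝ × ℝ → ℝ} (hF : AnalyticOnNhd ℝ F U)
    (hH : ∀ i, ∀ p ∈ U, DifferentiableAt ℝ (H i) p) (hH0 : ∀ i, ∀ p ∈ U, H i p ≠ 0)
    {p : ℝ × ℝ × ℝ} (hp : p ∈ U) {i j : Fin 3}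
    (h : pd (pd F i) j p =
      (pd (H i) j p / H i p) • pd F i p + (pd (H j) i p / H j p) • pd F j p) :
    pd (fun q => (H i q)⁻¹ • pd F i q) j p =
      (pd (H j) i p / H i p) • ((H j p)⁻¹ • pd F j p) := by
  have hdiff : DifferentiableAt ℝ (pd F i) p := (analyticAt_pd (hF p hp) i).differentiableAt
  have h1 := ((hasDerivAt_inv (hH0 i p hp)).comp_hasFDerivAt p (hH i p hp).hasFDerivAt).smul
    hdiff.hasFDerivAt
  have h2 : pd (fun q => (H i q)⁻¹ • pd F i q) j p =
      (H i p)⁻¹ • pd (pd F i) j p + (-(H i p ^ 2)⁻¹ * pd (H i) j p) • pd F i p := by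
    rw [pd]
    refine (congrArg (fun L => L (e j)) h1.fderiv).trans ?_
    simp [pd]
  have hi := hH0 i p hp
  have hj := hH0 j p hp
  rw [h2, h]
  match_scalars
  all_goals field_simp
  ring

/-! ### The frame equations on `z = 0` -/

theorem X0d_eq_mul_X0q (x : ℝ) : X0d x = x * X0q x := by
  rw [X0d_eq, X0q_eq]; ring

theorem hFun_eq_sub (x y : ℝ) :
    hFun x y = 2 * X0 x + √5 - (x ^ 2 - y ^ 2) * X0q x := by
  rw [hFun, X0d_eq_mul_X0q]; ring

theorem hasDerivAt_X0q {x : ℝ} (hx : x ≠ 0) : HasDerivAt X0q (C2 x / x) x := by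
  rw [show X0q = fun x => 2 * (G1 ∘ fun x => x ^ 2) x from funext X0q_eq, C2_eq]
  refine (((hasDerivAt_G1 (x ^ 2)).comp x (hasDerivAt_pow 2 x)).const_mul 2).congr_deriv ?_
  push_cast
  field_simp
  ring

/-- The term `2 X₀'` cancels against the derivative of the factor `x²`, so only the derivative `C₂ /
x` of `X₀'/x` survives. This is the source of `C₂` in `∂_y Xα`. -/
theorem hasDerivAt_hFun_fst {x : ℝ} (hx : x ≠ 0) (y : ℝ) :
    HasDerivAt (fun s => hFun s y) (-(x ^ 2 - y ^ 2) * C2 x / x) x := by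
  rw [show (fun s => hFun s y) = fun s => 2 * X0 s + √5 - (s ^ 2 - y ^ 2) * X0q s from
    funext fun s => hFun_eq_sub s y]
  have h0 : HasDerivAt X0 (x * X0q x) x := by
    rw [← X0d_eq_mul_X0q]; exact (contDiff_X0.differentiable (by simp) x).hasDerivAt
  refine (((h0.const_mul 2).add_const (√5)).sub
    (((hasDerivAt_pow 2 x).sub_const (y ^ 2)).mul (hasDerivAt_X0q hx))).congr_deriv ?_
  push_cast
  field_simp
  ring

theorem hasDerivAt_hFun_snd (x y : ℝ) : HasDerivAt (fun s => hFun x s) (2 * y * X0q x) y := by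
  rw [show (fun s => hFun x s) = fun s => 2 * X0 x + √5 - (x ^ 2 - s ^ 2) * X0q x from
    funext fun s => hFun_eq_sub x s]
  refine ((((hasDerivAt_pow 2 y).const_sub (x ^ 2)).mul_const (X0q x)).const_sub _).congr_deriv ?_
  push_cast
  ring

/-- The partial derivative in the first variable. -/
noncomputable def dx (G : ℝ × ℝ → E4) (p : ℝ × ℝ) : E4 := fderiv ℝ G p (1, 0)

/-- The partial derivative in the second variable. -/
noncomputable def dy (G : ℝ × ℝ → E4) (p : ℝ × ℝ) : E4 := fderiv ℝ G p (0, 1)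

/-- The first Lamé coefficient of a curvature surface. -/
noncomputable def lameX (p : ℝ × ℝ) : ℝ := (p.1 ^ 2 - p.2 ^ 2) / (p.1 * hFun p.1 p.2)

/-- The second Lamé coefficient of a curvature surface. -/
noncomputable def lameY (p : ℝ × ℝ) : ℝ := 2 * p.2 / hFun p.1 p.2

/-- The equations at `p` for the derivatives of a curvature surface and its frame, as far as they
express derivatives by a single frame vector, and orthonormality of the frame. -/
structure FrameEquationsAt (f φ Xα Xβ ξ : ℝ × ℝ → E4) (p : ℝ × ℝ) : Prop where
  dx_f : dx f p = lameX p • Xα p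
  dy_f : dy f p = lameY p • Xβ p
  dx_φ : dx φ p = (-(p.2 * (2 * X0 p.1 + √5)) / (p.1 * hFun p.1 p.2)) • Xα p
  dx_Xβ : dx Xβ p = (-(2 * X0 p.1 + √5) / (p.1 * hFun p.1 p.2)) • Xα p
  dx_ξ : dx ξ p = (-(2 * X0 p.1 + √5) / (2 * (p.1 * hFun p.1 p.2)) - √5 * lameX p) • Xα p
  dy_Xα : dy Xα p = (C2 p.1 * lameY p) • Xβ p
  dy_ξ : dy ξ p = (B2 p.1 * lameY p) • Xβ p
  φ_φ : inner ℝ (φ p) (φ p) = (1 : ℝ)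
  α_α : inner ℝ (Xα p) (Xα p) = (1 : ℝ)
  β_β : inner ℝ (Xβ p) (Xβ p) = (1 : ℝ)
  ξ_ξ : inner ℝ (ξ p) (ξ p) = (1 : ℝ)
  φ_α : inner ℝ (φ p) (Xα p) = (0 : ℝ)
  φ_β : inner ℝ (φ p) (Xβ p) = (0 : ℝ)
  φ_ξ : inner ℝ (φ p) (ξ p) = (0 : ℝ)
  α_β : inner ℝ (Xα p) (Xβ p) = (0 : ℝ)
  α_ξ : inner ℝ (Xα p) (ξ p) = (0 : ℝ)
  β_ξ : inner ℝ (Xβ p) (ξ p) = (0 : ℝ)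

section Slice

variable {X : Type*} [NormedAddCommGroup X] [NormedSpace ℝ X]

theorem hasFDerivAt_slice (p : ℝ × ℝ) :
    HasFDerivAt (fun p : ℝ × ℝ => (p.1, p.2, (0 : ℝ)))
      ((ContinuousLinearMap.fst ℝ ℝ ℝ).prod
        ((ContinuousLinearMap.snd ℝ ℝ ℝ).prod (0 : ℝ × ℝ →L[ℝ] ℝ))) p :=
  hasFDerivAt_fst.prodMk (hasFDerivAt_snd.prodMk (hasFDerivAt_const 0 p))

theorem fderiv_slice {G : ℝ × ℝ → X} {K : ℝ × ℝ × ℝ → X} {V : Set (ℝ × ℝ)} (hV : IsOpen V)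
    {x y : ℝ} (hp : (x, y) ∈ V) (h : ∀ x y, (x, y) ∈ V → G (x, y) = K (x, y, 0))
    (hK : DifferentiableAt ℝ K (x, y, 0)) (v : ℝ × ℝ) :
    fderiv ℝ G (x, y) v = fderiv ℝ K (x, y, 0) (v.1, v.2, 0) := by
  have h1 : G =ᶠ[𝓝 (x, y)] K ∘ fun p => (p.1, p.2, 0) :=
    eventuallyEq_of_mem (hV.mem_nhds hp) fun p hp => h p.1 p.2 hp
  rw [h1.fderiv_eq, (HasFDerivAt.comp (x, y) (g := K) hK.hasFDerivAt
    (hasFDerivAt_slice (x, y))).fderiv]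
  rfl

theorem pd_zero_slice {K : ℝ × ℝ × ℝ → ℝ} {V : Set (ℝ × ℝ)} (hV : IsOpen V)
    {x y : ℝ} (hp : (x, y) ∈ V) {g : ℝ × ℝ → ℝ} (h : ∀ x y, (x, y) ∈ V → K (x, y, 0) = g (x, y))
    (hK : DifferentiableAt ℝ K (x, y, 0)) {d : ℝ} (hd : HasDerivAt (fun s => g (s, y)) d x) :
    pd K 0 (x, y, 0) = d := by
  have h2 : HasDerivAt (fun s : ℝ => (s, y, (0 : ℝ))) (1, 0, 0) x :=
    (hasDerivAt_id x).prodMk ((hasDerivAt_const x y).prodMk (hasDerivAt_const x 0))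
  have h3 := HasFDerivAt.comp_hasDerivAt (l := K) x hK.hasFDerivAt h2
  have h4 : (K ∘ fun s => (s, y, 0)) =ᶠ[𝓝 x] fun s => g (s, y) := by
    have : ∀ᶠ s in 𝓝 x, (s, y) ∈ V :=
      (Continuous.prodMk_left y).continuousAt.eventually_mem (hV.mem_nhds hp)
    filter_upwards [this] with s hs using h s y hs
  exact (h3.congr_of_eventuallyEq h4.symm).unique hd

theorem pd_one_slice {K : ℝ × ℝ × ℝ → ℝ} {V : Set (ℝ × ℝ)} (hV : IsOpen V)
    {x y : ℝ} (hp : (x, y) ∈ V) {g : ℝ × ℝ → ℝ} (h : ∀ x y, (x, y) ∈ V → K (x, y, 0) = g (x, y))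
    (hK : DifferentiableAt ℝ K (x, y, 0)) {d : ℝ} (hd : HasDerivAt (fun s => g (x, s)) d y) :
    pd K 1 (x, y, 0) = d := by
  have h2 : HasDerivAt (fun s : ℝ => (x, s, (0 : ℝ))) (0, 1, 0) y :=
    (hasDerivAt_const y x).prodMk ((hasDerivAt_id y).prodMk (hasDerivAt_const y 0))
  have h3 := HasFDerivAt.comp_hasDerivAt (l := K) y hK.hasFDerivAt h2
  have h4 : (K ∘ fun s => (x, s, 0)) =ᶠ[𝓝 y] fun s => g (x, s) := by
    have : ∀ᶠ s in 𝓝 y, (x, s) ∈ V :=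
      (Continuous.prodMk_right x).continuousAt.eventually_mem (hV.mem_nhds hp)
    filter_upwards [this] with s hs using h x s hs
  exact (h3.congr_of_eventuallyEq h4.symm).unique hd

end Slice

/-- The Lamé coefficients `P cos φ`, `P sin φ`, `P` of a Guichard net. -/
noncomputable def lame (ang P : ℝ × ℝ × ℝ → ℝ) : Fin 3 → ℝ × ℝ × ℝ → ℝ :=
  ![fun q => P q * Real.cos (ang q), fun q => P q * Real.sin (ang q), P]

theorem HasGuichardNet.inner_fderiv {U : Set (ℝ × ℝ × ℝ)} {F : ℝ × ℝ × ℝ → E4}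
    {κ : Fin 3 → ℝ × ℝ × ℝ → ℝ} {ang P : ℝ × ℝ × ℝ → ℝ} (h : HasGuichardNet U F κ ang P)
    {p : ℝ × ℝ × ℝ} (hp : p ∈ U) (v w : ℝ × ℝ × ℝ) :
    inner ℝ (fderiv ℝ F p v) (fderiv ℝ F p w) =
      P p ^ 2 * (Real.cos (ang p) ^ 2 * (v.1 * w.1) + Real.sin (ang p) ^ 2 * (v.2.1 * w.2.1) +
        v.2.2 * w.2.2) := by
  have h1 := h.firstFF_eq p hp (v + w)
  have h2 := h.firstFF_eq p hp v
  have h3 := h.firstFF_eq p hp w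
  simp only [firstFF, map_add, norm_add_sq_real, Prod.fst_add, Prod.snd_add] at h1 h2 h3
  linear_combination (h1 - h2 - h3) / 2

/-- The `x`- and `y`-derivatives of the Lamé coefficients come from their closed forms on `z = 0`;
the `z`-derivatives come from the prescribed `φ_z` and `(P⁻¹)_z`. -/
theorem frameEquationsAt_of_hypersurface {f φ Xα Xβ ξ : ℝ × ℝ → E4} {V : Set (ℝ × ℝ)} {ε : ℝ}
    {F N : ℝ × ℝ × ℝ → E4} {κ : Fin 3 → ℝ × ℝ × ℝ → ℝ} {ang P : ℝ × ℝ × ℝ → ℝ}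
    (hV : IsOpen V) (hVS : V ⊆ D \ S) (hε : 0 < ε)
    (hF : IsGenericConformallyFlatHypersurface
      {q | (q.1, q.2.1) ∈ V ∧ q.2.2 ∈ Set.Ioo (-ε) ε} F N κ)
    (hG : HasGuichardNet {q | (q.1, q.2.1) ∈ V ∧ q.2.2 ∈ Set.Ioo (-ε) ε} F κ ang P)
    (hI : HasInitialData V κ ang P)
    (hres : ∀ x y, (x, y) ∈ V →
      f (x, y) = F (x, y, 0) ∧
      φ (x, y) = N (x, y, 0) ∧
      Xα (x, y) =
        (P (x, y, 0) * Real.cos (ang (x, y, 0)))⁻¹ • fderiv ℝ F (x, y, 0) (e 0) ∧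
      Xβ (x, y) =
        (P (x, y, 0) * Real.sin (ang (x, y, 0)))⁻¹ • fderiv ℝ F (x, y, 0) (e 1) ∧
      ξ (x, y) = (P (x, y, 0))⁻¹ • fderiv ℝ F (x, y, 0) (e 2))
    {x y : ℝ} (hp : (x, y) ∈ V) : FrameEquationsAt f φ Xα Xβ ξ (x, y) := by
  set U : Set (ℝ × ℝ × ℝ) := {q | (q.1, q.2.1) ∈ V ∧ q.2.2 ∈ Set.Ioo (-ε) ε} with hUdef
  have hU : IsOpen U := (hV.preimage (by fun_prop)).inter (isOpen_Ioo.preimage (by fun_prop))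
  have hVU : ∀ x y, (x, y) ∈ V → (x, y, (0 : ℝ)) ∈ U := fun x y h => ⟨h, by simpa using hε⟩
  have hpU := hVU x y hp
  have hcs : ∀ q ∈ U, Real.cos (ang q) ≠ 0 ∧ Real.sin (ang q) ≠ 0 := fun q hq =>
    ⟨right_ne_zero_of_mul (hG.ang_regular q hq), left_ne_zero_of_mul (hG.ang_regular q hq)⟩
  have hang : ∀ q ∈ U, DifferentiableAt ℝ ang q := fun q hq =>
    (hG.analytic_ang q hq).differentiableAt
  have hP : ∀ q ∈ U, DifferentiableAt ℝ P q := fun q hq => (hG.analytic_P q hq).differentiableAt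
  set H := lame ang P with hHdef
  have hH : ∀ i, ∀ q ∈ U, DifferentiableAt ℝ (H i) q := by
    intro i q hq
    have := hang q hq
    have := hP q hq
    fin_cases i
    · exact (hP q hq).mul (hang q hq).cos
    · exact (hP q hq).mul (hang q hq).sin
    · exact hP q hq
  have hH0 : ∀ i, ∀ q ∈ U, H i q ≠ 0 := by
    intro i q hq
    fin_cases i
    · exact mul_ne_zero (hG.P_ne_zero q hq) (hcs q hq).1
    · exact mul_ne_zero (hG.P_ne_zero q hq) (hcs q hq).2
    · exact hG.P_ne_zero q hq
  have hd : ∀ i, ∀ q ∈ U, inner ℝ (pd F i q) (pd F i q) = H i q ^ 2 := by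
    intro i q hq
    rw [pd, hG.inner_fderiv hq]
    fin_cases i <;> simp [e, hHdef, lame, mul_pow]
  have ho : ∀ i j, i ≠ j → ∀ q ∈ U, inner ℝ (pd F i q) (pd F j q) = 0 := by
    intro i j hij q hq
    rw [pd, pd, hG.inner_fderiv hq]
    fin_cases i <;> fin_cases j <;> first | exact absurd rfl hij | simp [e]
  have hNF : ∀ q ∈ U, ∀ i, inner ℝ (N q) (pd F i q) = 0 := fun q hq i =>
    hF.normal_orth q hq (e i)
  have hpp : ∀ i j, i ≠ j → pd (fun q => (H i q)⁻¹ • pd F i q) j (x, y, 0) =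
      (pd (H j) i (x, y, 0) / H i (x, y, 0)) • ((H j (x, y, 0))⁻¹ • pd F j (x, y, 0)) :=
    fun i j hij => pd_normalized_of_orthogonal hF.analytic hH hH0 hpU
      (pd_pd_of_orthogonal hU hF.analytic hF.analytic_normal hF.norm_normal hNF hF.principal
        hH hH0 hd ho hpU hij)
  have hEdiff : ∀ i, DifferentiableAt ℝ (fun q => (H i q)⁻¹ • pd F i q) (x, y, 0) := fun i =>
    ((hH i _ hpU).inv (hH0 i _ hpU)).smul (analyticAt_pd (hF.analytic _ hpU) i).differentiableAt
  -- the explicit data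
  obtain ⟨hD, hS⟩ := hVS hp
  have hx : 0 < x := hD
  have hS1 : x * y * (x ^ 2 - y ^ 2) ≠ 0 := fun h0 => hS (Or.inl h0)
  have hy : y ≠ 0 := right_ne_zero_of_mul (left_ne_zero_of_mul hS1)
  have hxy : x ^ 2 - y ^ 2 ≠ 0 := right_ne_zero_of_mul hS1
  have hh := (hFun_pos x y).ne'
  have hr : x ^ 2 + y ^ 2 ≠ 0 := by positivity
  have hPV : ∀ x y, (x, y) ∈ V → P (x, y, 0) = (x ^ 2 + y ^ 2) / (x * hFun x y) := by
    intro x y h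
    rw [hI.P_eq x y h, Pbar, div_mul_eq_mul_div, inv_div]
  have hHX : ∀ x y, (x, y) ∈ V → H 0 (x, y, 0) = lameX (x, y) := by
    intro x y h
    have hx : 0 < x := (hVS h).1
    have := (hFun_pos x y).ne'
    change P (x, y, 0) * Real.cos (ang (x, y, 0)) = _
    rw [hPV x y h, hI.cos_ang x y h, lameX]
    field_simp
  have hHY : ∀ x y, (x, y) ∈ V → H 1 (x, y, 0) = lameY (x, y) := by
    intro x y h
    have hx : 0 < x := (hVS h).1
    have := (hFun_pos x y).ne'
    change P (x, y, 0) * Real.sin (ang (x, y, 0)) = _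
    rw [hPV x y h, hI.sin_ang x y h, lameY]
    field_simp
  have d10 : pd (H 0) 1 (x, y, 0) =
      (-(2 * y) * (x * hFun x y) - (x ^ 2 - y ^ 2) * (x * (2 * y * X0q x))) /
        (x * hFun x y) ^ 2 := by
    refine pd_one_slice hV hp hHX (hH 0 _ hpU) ?_
    refine (((hasDerivAt_pow 2 y).const_sub (x ^ 2)).div
      ((hasDerivAt_hFun_snd x y).const_mul x) (mul_ne_zero hx.ne' hh)).congr_deriv ?_
    push_cast
    ring
  have d01 : pd (H 1) 0 (x, y, 0) =
      -(2 * y * (-(x ^ 2 - y ^ 2) * C2 x / x)) / hFun x y ^ 2 := by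
    refine pd_zero_slice hV hp hHY (hH 1 _ hpU) ?_
    refine ((hasDerivAt_const x (2 * y)).div
      (hasDerivAt_hFun_fst hx.ne' y) hh).congr_deriv ?_
    ring
  -- The data prescribe the derivative of `P⁻¹`, hence the factor `-P²`.
  have dP : pd P 2 (x, y, 0) = -(P (x, y, 0) ^ 2 * PbarInvZ x y) := by
    have h1 := ((hasDerivAt_inv (hG.P_ne_zero _ hpU)).comp_hasFDerivAt (x, y, (0 : ℝ))
      (hP _ hpU).hasFDerivAt)
    have h2 := congrArg (fun L => L (e 2)) h1.fderiv
    have h3 := hI.P_inv_z x y hp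
    have h0 := hG.P_ne_zero _ hpU
    have h4 : PbarInvZ x y = -(P (x, y, 0) ^ 2)⁻¹ * pd P 2 (x, y, 0) := h3.symm.trans h2
    rw [h4]
    field_simp
  have d20 : pd (H 0) 2 (x, y, 0) = pd P 2 (x, y, 0) * Real.cos (ang (x, y, 0)) -
      P (x, y, 0) * (Real.sin (ang (x, y, 0)) * (y / (x ^ 2 + y ^ 2))) := by
    rw [← hI.ang_z x y hp]
    refine (congrArg (fun L => L (e 2))
      ((hP _ hpU).hasFDerivAt.mul (hang _ hpU).hasFDerivAt.cos).fderiv).trans ?_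
    simp [pd]
    ring
  have d21 : pd (H 1) 2 (x, y, 0) = pd P 2 (x, y, 0) * Real.sin (ang (x, y, 0)) +
      P (x, y, 0) * (Real.cos (ang (x, y, 0)) * (y / (x ^ 2 + y ^ 2))) := by
    rw [← hI.ang_z x y hp]
    refine (congrArg (fun L => L (e 2))
      ((hP _ hpU).hasFDerivAt.mul (hang _ hpU).hasFDerivAt.sin).fderiv).trans ?_
    simp [pd]
    ring
  -- the frame
  have rα : ∀ x y, (x, y) ∈ V → Xα (x, y) = (fun q => (H 0 q)⁻¹ • pd F 0 q) (x, y, 0) :=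
    fun x y h => (hres x y h).2.2.1
  have rβ : ∀ x y, (x, y) ∈ V → Xβ (x, y) = (fun q => (H 1 q)⁻¹ • pd F 1 q) (x, y, 0) :=
    fun x y h => (hres x y h).2.2.2.1
  have rξ : ∀ x y, (x, y) ∈ V → ξ (x, y) = (fun q => (H 2 q)⁻¹ • pd F 2 q) (x, y, 0) :=
    fun x y h => (hres x y h).2.2.2.2
  have rφ : ∀ x y, (x, y) ∈ V → φ (x, y) = N (x, y, 0) := fun x y h => (hres x y h).2.1
  have rf : ∀ x y, (x, y) ∈ V → f (x, y) = F (x, y, 0) := fun x y h => (hres x y h).1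
  have hFi : ∀ i, pd F i (x, y, 0) =
      H i (x, y, 0) • ((H i (x, y, 0))⁻¹ • pd F i (x, y, 0)) := fun i => by
    rw [smul_smul, mul_inv_cancel₀ (hH0 i _ hpU), one_smul]
  have eα := rα x y hp
  have eβ := rβ x y hp
  have eξ := rξ x y hp
  have eφ := rφ x y hp
  have hone : ∀ i, inner ℝ ((H i (x, y, 0))⁻¹ • pd F i (x, y, 0))
      ((H i (x, y, 0))⁻¹ • pd F i (x, y, 0)) = (1 : ℝ) := fun i => by
    have := hH0 i _ hpU
    rw [inner_smul_left, inner_smul_right, hd i _ hpU]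
    simp only [conj_trivial]
    field_simp
  have hzero : ∀ i j, i ≠ j → inner ℝ ((H i (x, y, 0))⁻¹ • pd F i (x, y, 0))
      ((H j (x, y, 0))⁻¹ • pd F j (x, y, 0)) = (0 : ℝ) := fun i j hij => by
    rw [inner_smul_left, inner_smul_right, ho i j hij _ hpU]
    simp
  have hφi : ∀ i, inner ℝ (N (x, y, 0)) ((H i (x, y, 0))⁻¹ • pd F i (x, y, 0)) = (0 : ℝ) :=
    fun i => by rw [inner_smul_right, hNF _ hpU, mul_zero]
  have vX : H 0 (x, y, 0) = (x ^ 2 - y ^ 2) / (x * hFun x y) := hHX x y hp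
  have vY : H 1 (x, y, 0) = 2 * y / hFun x y := hHY x y hp
  have vZ : H 2 (x, y, 0) = (x ^ 2 + y ^ 2) / (x * hFun x y) := hPV x y hp
  have hhs := hFun_eq_sub x y
  have hT : 2 * X0 x + √5 = hFun x y + (x ^ 2 - y ^ 2) * X0q x := by rw [hhs]; ring
  -- Eliminating `X₀` in favour of `h` makes the coefficient identities below rational in `x`, `y`,
  -- `h`, `X₀'/x` and `√5`.
  have hX0 : X0 x = (hFun x y + (x ^ 2 - y ^ 2) * X0q x - √5) / 2 := by rw [hhs]; ring
  refine ⟨?_, ?_, ?_, ?_, ?_, ?_, ?_, ?_, ?_, ?_, ?_, ?_, ?_, ?_, ?_, ?_, ?_⟩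
  · rw [dx, fderiv_slice hV hp rf (hF.analytic _ hpU).differentiableAt, eα, ← hHX x y hp]
    exact hFi 0
  · rw [dy, fderiv_slice hV hp rf (hF.analytic _ hpU).differentiableAt, eβ, ← hHY x y hp]
    exact hFi 1
  · rw [dx, fderiv_slice hV hp rφ (hF.analytic_normal _ hpU).differentiableAt, eα]
    refine (hF.principal _ hpU 0).trans ?_
    rw [show fderiv ℝ F (x, y, 0) (e 0) = pd F 0 (x, y, 0) from rfl]
    nth_rw 1 [hFi 0]
    rw [smul_smul]
    congr 1
    rw [hG.kappa1 _ hpU, vX, hPV x y hp, hI.cos_ang x y hp, hI.sin_ang x y hp,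
      hI.kappa3 x y hp, kappaBar3, X0d_eq_mul_X0q, hX0]
    field_simp
    ring
  · rw [dx, fderiv_slice hV hp rβ (hEdiff 1), eα]
    refine (hpp 1 0 (by decide)).trans ?_
    congr 1
    rw [d10, vY, hT]
    field_simp
    ring
  · rw [dx, fderiv_slice hV hp rξ (hEdiff 2), eα]
    refine (hpp 2 0 (by decide)).trans ?_
    congr 1
    rw [d20, dP, vZ, hPV x y hp, hI.cos_ang x y hp, hI.sin_ang x y hp, PbarInvZ, lameX,
      X0d_eq_mul_X0q, hX0]
    field_simp
    ring
  · rw [dy, fderiv_slice hV hp rα (hEdiff 0), eβ]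
    refine (hpp 0 1 (by decide)).trans ?_
    congr 1
    rw [d01, vX, lameY]
    field_simp
  · rw [dy, fderiv_slice hV hp rξ (hEdiff 2), eβ]
    refine (hpp 2 1 (by decide)).trans ?_
    congr 1
    rw [d21, dP, vZ, hPV x y hp, hI.cos_ang x y hp, hI.sin_ang x y hp, PbarInvZ, lameY, B2,
      X0d_eq_mul_X0q, hX0]
    field_simp
    ring
  · rw [eφ, real_inner_self_eq_norm_sq, hF.norm_normal _ hpU, one_pow]
  · rw [eα]; exact hone 0
  · rw [eβ]; exact hone 1
  · rw [eξ]; exact hone 2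
  · rw [eφ, eα]; exact hφi 0
  · rw [eφ, eβ]; exact hφi 1
  · rw [eφ, eξ]; exact hφi 2
  · rw [eα, eβ]; exact hzero 0 1 (by decide)
  · rw [eα, eξ]; exact hzero 0 2 (by decide)
  · rw [eβ, eξ]; exact hzero 1 2 (by decide)

/-! ### Extension of the frame equations to the half plane -/

theorem isPreconnected_D : IsPreconnected D :=
  ((convex_Ioi (0 : ℝ)).linear_preimage (LinearMap.fst ℝ ℝ ℝ)).isPreconnected

theorem eqOn_D_of_eqOn {X : Type*} [NormedAddCommGroup X] [NormedSpace ℝ X] {V : Set (ℝ × ℝ)}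
    (hV : IsOpen V) (hne : V.Nonempty) (hVD : V ⊆ D) {G K : ℝ × ℝ → X}
    (hG : ∀ p ∈ D, AnalyticAt ℝ G p) (hK : ∀ p ∈ D, AnalyticAt ℝ K p)
    (h : ∀ p ∈ V, G p = K p) : ∀ p ∈ D, G p = K p := by
  obtain ⟨p₀, hp₀⟩ := hne
  exact AnalyticOnNhd.eqOn_of_preconnected_of_eventuallyEq (𝕜 := ℝ) hG hK isPreconnected_D
    (hVD hp₀) (eventuallyEq_of_mem (hV.mem_nhds hp₀) h)

theorem analyticAt_X0_fst (p : ℝ × ℝ) : AnalyticAt ℝ (fun p : ℝ × ℝ => X0 p.1) p :=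
  (contDiff_X0.comp contDiff_fst).contDiffAt.analyticAt

theorem analyticAt_B2_fst (p : ℝ × ℝ) : AnalyticAt ℝ (fun p : ℝ × ℝ => B2 p.1) p :=
  (contDiff_B2.comp contDiff_fst).contDiffAt.analyticAt

theorem analyticAt_C2_fst (p : ℝ × ℝ) : AnalyticAt ℝ (fun p : ℝ × ℝ => C2 p.1) p :=
  (contDiff_C2.comp contDiff_fst).contDiffAt.analyticAt

theorem analyticAt_hFun (p : ℝ × ℝ) : AnalyticAt ℝ (fun p : ℝ × ℝ => hFun p.1 p.2) p := by
  rw [show (fun p : ℝ × ℝ => hFun p.1 p.2) = fun p : ℝ × ℝ =>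
    2 * X0 p.1 + √5 - (p.1 ^ 2 - p.2 ^ 2) * X0q p.1 from funext fun p => hFun_eq_sub _ _]
  have h1 := contDiff_X0.comp (contDiff_fst (E := ℝ) (F := ℝ))
  have h2 := contDiff_X0q.comp (contDiff_fst (E := ℝ) (F := ℝ))
  simp only [Function.comp_def] at h1 h2
  refine ContDiffAt.analyticAt (ContDiff.contDiffAt ?_)
  fun_prop

theorem analyticAt_lameX {p : ℝ × ℝ} (hp : p ∈ D) : AnalyticAt ℝ lameX p := by
  have h := analyticAt_hFun p
  have h0 : p.1 * hFun p.1 p.2 ≠ 0 := mul_ne_zero (ne_of_gt hp) (hFun_pos _ _).ne'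
  exact ((analyticAt_fst.pow 2).sub (analyticAt_snd.pow 2)).div (analyticAt_fst.mul h) h0

theorem analyticAt_lameY (p : ℝ × ℝ) : AnalyticAt ℝ lameY p := by
  have h := analyticAt_hFun p
  have h0 : hFun p.1 p.2 ≠ 0 := (hFun_pos _ _).ne'
  exact (analyticAt_const.mul analyticAt_snd).div h h0

theorem analyticAt_fderiv_apply {G : ℝ × ℝ → E4} {p : ℝ × ℝ} (h : AnalyticAt ℝ G p) (v : ℝ × ℝ) :
    AnalyticAt ℝ (fun q => fderiv ℝ G q v) p :=
  ((ContinuousLinearMap.apply ℝ E4 v).analyticAt _).comp h.fderiv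

theorem analyticAt_inner {G K : ℝ × ℝ → E4} {p : ℝ × ℝ} (hG : AnalyticAt ℝ G p)
    (hK : AnalyticAt ℝ K p) : AnalyticAt ℝ (fun q => (inner ℝ (G q) (K q) : ℝ)) p :=
  (hG.contDiffAt.inner ℝ hK.contDiffAt).analyticAt

/-- Both sides are analytic on the connected set `D`, since the only denominators are `h` and `x h`
up to constants, and they agree on the open set `V`. -/
theorem IsCurvatureSurface.frameEquationsAt {f φ Xα Xβ ξ : ℝ × ℝ → E4}
    (hf : IsCurvatureSurface f φ Xα Xβ ξ) {p : ℝ × ℝ} (hp : p ∈ D) :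
    FrameEquationsAt f φ Xα Xβ ξ p := by
  obtain ⟨V, ε, F, N, κ, ang, P, hV, hVc, hVS, hε, hF, hG, hI, hres⟩ := hf.hypersurface
  have key : ∀ q ∈ V, FrameEquationsAt f φ Xα Xβ ξ q := fun q hq =>
    frameEquationsAt_of_hypersurface hV hVS hε hF hG hI hres hq
  have hVD : V ⊆ D := fun q hq => (hVS hq).1
  have aV : ∀ {G K : ℝ × ℝ → E4}, (∀ p ∈ D, AnalyticAt ℝ G p) → (∀ p ∈ D, AnalyticAt ℝ K p) →
      (∀ p ∈ V, G p = K p) → G p = K p := fun h1 h2 h =>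
    eqOn_D_of_eqOn hV hVc.nonempty hVD h1 h2 h p hp
  have aI : ∀ {G K : ℝ × ℝ → E4} {c : ℝ}, AnalyticOnNhd ℝ G D → AnalyticOnNhd ℝ K D →
      (∀ p ∈ V, inner ℝ (G p) (K p) = c) → inner ℝ (G p) (K p) = c := fun {G K c} h1 h2 h =>
    eqOn_D_of_eqOn (G := fun q => (inner ℝ (G q) (K q) : ℝ)) (K := fun _ => c) hV hVc.nonempty hVD
      (fun q hq => analyticAt_inner (h1 q hq) (h2 q hq)) (fun q _ => analyticAt_const) h p hp
  have aT : ∀ p : ℝ × ℝ, AnalyticAt ℝ (fun p : ℝ × ℝ => 2 * X0 p.1 + √5) p := fun p =>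
    (analyticAt_const.mul (analyticAt_X0_fst p)).add analyticAt_const
  have axh : ∀ p : ℝ × ℝ, AnalyticAt ℝ (fun p : ℝ × ℝ => p.1 * hFun p.1 p.2) p := fun p =>
    analyticAt_fst.mul (analyticAt_hFun p)
  have hxh : ∀ p ∈ D, p.1 * hFun p.1 p.2 ≠ 0 := fun p hp =>
    mul_ne_zero (ne_of_gt hp) (hFun_pos _ _).ne'
  exact {
    dx_f := aV (fun q hq => analyticAt_fderiv_apply (hf.analytic q hq) _)
      (fun q hq => (analyticAt_lameX hq).smul (hf.analytic_Xα q hq)) fun q hq => (key q hq).dx_f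
    dy_f := aV (fun q hq => analyticAt_fderiv_apply (hf.analytic q hq) _)
      (fun q hq => (analyticAt_lameY q).smul (hf.analytic_Xβ q hq)) fun q hq => (key q hq).dy_f
    dx_φ := aV (fun q hq => analyticAt_fderiv_apply (hf.analytic_φ q hq) _)
      (fun q hq => ((analyticAt_snd.mul (aT q)).neg.div (axh q) (hxh q hq)).smul
        (hf.analytic_Xα q hq)) fun q hq => (key q hq).dx_φ
    dx_Xβ := aV (fun q hq => analyticAt_fderiv_apply (hf.analytic_Xβ q hq) _)
      (fun q hq => ((aT q).neg.div (axh q) (hxh q hq)).smul (hf.analytic_Xα q hq))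
      fun q hq => (key q hq).dx_Xβ
    dx_ξ := aV (fun q hq => analyticAt_fderiv_apply (hf.analytic_ξ q hq) _)
      (fun q hq => (((aT q).neg.div (analyticAt_const.mul (axh q))
        (mul_ne_zero two_ne_zero (hxh q hq))).sub
        (analyticAt_const.mul (analyticAt_lameX hq))).smul (hf.analytic_Xα q hq))
      fun q hq => (key q hq).dx_ξ
    dy_Xα := aV (fun q hq => analyticAt_fderiv_apply (hf.analytic_Xα q hq) _)
      (fun q hq => ((analyticAt_C2_fst q).mul (analyticAt_lameY q)).smul (hf.analytic_Xβ q hq))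
      fun q hq => (key q hq).dy_Xα
    dy_ξ := aV (fun q hq => analyticAt_fderiv_apply (hf.analytic_ξ q hq) _)
      (fun q hq => ((analyticAt_B2_fst q).mul (analyticAt_lameY q)).smul (hf.analytic_Xβ q hq))
      fun q hq => (key q hq).dy_ξ
    φ_φ := aI hf.analytic_φ hf.analytic_φ fun q hq => (key q hq).φ_φ
    α_α := aI hf.analytic_Xα hf.analytic_Xα fun q hq => (key q hq).α_α
    β_β := aI hf.analytic_Xβ hf.analytic_Xβ fun q hq => (key q hq).β_β
    ξ_ξ := aI hf.analytic_ξ hf.analytic_ξ fun q hq => (key q hq).ξ_ξ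
    φ_α := aI hf.analytic_φ hf.analytic_Xα fun q hq => (key q hq).φ_α
    φ_β := aI hf.analytic_φ hf.analytic_Xβ fun q hq => (key q hq).φ_β
    φ_ξ := aI hf.analytic_φ hf.analytic_ξ fun q hq => (key q hq).φ_ξ
    α_β := aI hf.analytic_Xα hf.analytic_Xβ fun q hq => (key q hq).α_β
    α_ξ := aI hf.analytic_Xα hf.analytic_ξ fun q hq => (key q hq).α_ξ
    β_ξ := aI hf.analytic_Xβ hf.analytic_ξ fun q hq => (key q hq).β_ξ }

/-! ### Coordinate curves -/

theorem hasDerivAt_dx {G : ℝ × ℝ → E4} (hG : AnalyticOnNhd ℝ G D) {x : ℝ} (hx : 0 < x) (y : ℝ) :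
    HasDerivAt (fun s => G (s, y)) (dx G (x, y)) x :=
  HasFDerivAt.comp_hasDerivAt (l := G) x (hG (x, y) hx).differentiableAt.hasFDerivAt
    ((hasDerivAt_id x).prodMk (hasDerivAt_const x y))

theorem hasDerivAt_dy {G : ℝ × ℝ → E4} (hG : AnalyticOnNhd ℝ G D) {x : ℝ} (hx : 0 < x) (y : ℝ) :
    HasDerivAt (fun s => G (x, s)) (dy G (x, y)) y :=
  HasFDerivAt.comp_hasDerivAt (l := G) y (hG (x, y) hx).differentiableAt.hasFDerivAt
    ((hasDerivAt_const y x).prodMk (hasDerivAt_id y))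

theorem analyticAt_curveX {G : ℝ × ℝ → E4} (hG : AnalyticOnNhd ℝ G D) {x : ℝ} (hx : 0 < x)
    (y : ℝ) : AnalyticAt ℝ (fun s => G (s, y)) x :=
  AnalyticAt.comp (g := G) (hG (x, y) hx) (analyticAt_id.prod analyticAt_const)

theorem analyticAt_curveY {G : ℝ × ℝ → E4} (hG : AnalyticOnNhd ℝ G D) {x : ℝ} (hx : 0 < x)
    (y : ℝ) : AnalyticAt ℝ (fun s => G (x, s)) y :=
  AnalyticAt.comp (g := G) (hG (x, y) hx) (analyticAt_const.prod analyticAt_id)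

theorem eq_one_of_hasDerivAt_zero {g : ℝ → E4} (h : ∀ x, 0 < x → HasDerivAt g 0 x) {x : ℝ}
    (hx : 0 < x) : g x = g 1 :=
  isOpen_Ioi.is_const_of_deriv_eq_zero (convex_Ioi (0 : ℝ)).isPreconnected
    (fun s hs => (h s hs).differentiableAt.differentiableWithinAt)
    (fun s hs => (h s hs).deriv) hx (mem_Ioi.2 one_pos)

theorem eq_zero_of_hasDerivAt_zero {g : ℝ → E4} (h : ∀ y, HasDerivAt g 0 y) (y : ℝ) :
    g y = g 0 :=
  is_const_of_deriv_eq_zero (fun s => (h s).differentiableAt) (fun s => (h s).deriv) y 0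

theorem mem_sphereIn {n c q w : E4} {r : ℝ} (hr : 0 ≤ r) (hw : ‖w‖ = 1) (hn : inner ℝ n w = (0 : ℝ))
    (hq : q = r • w + c) : q ∈ sphereIn n c r := by
  constructor
  · rw [mem_sphere_iff_norm, hq, add_sub_cancel_right, norm_smul, hw, Real.norm_of_nonneg hr,
      mul_one]
  · change inner ℝ n (q - c) = 0
    rw [hq, add_sub_cancel_right, inner_smul_right, hn, mul_zero]

theorem norm_inv_sqrt_smul {w : E4} {s : ℝ} (hs : 0 < s) (hw : inner ℝ w w = s) :
    ‖(√s)⁻¹ • w‖ = 1 := by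
  rw [real_inner_self_eq_norm_sq] at hw
  have : √s = ‖w‖ := by rw [← hw, Real.sqrt_sq (norm_nonneg _)]
  rw [norm_smul, this, norm_inv, norm_norm, inv_mul_cancel₀]
  rw [← this]; positivity

/-- The roots of `5 + 4y²` cancel and those of `1 + y²` combine, leaving a rational factor that is
easy to differentiate. -/
theorem radX_smul_vecX (φ Xβ ξ : ℝ × ℝ → E4) (x y : ℝ) :
    radX y • vecX φ Xβ ξ x y = (2 * √5 * (1 + y ^ 2))⁻¹ •
      (Xβ (x, y) - (2 * (1 + y ^ 2)) • ξ (x, y) + y • φ (x, y)) := by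
  rw [radX, vecX, smul_smul]
  congr 1
  have h1 : 0 < √(1 + y ^ 2) := by positivity
  have h2 : 0 < √(5 + 4 * y ^ 2) := by positivity
  rw [Real.sqrt_div (by positivity), Real.sqrt_mul (by positivity)]
  nth_rw 3 [← Real.sq_sqrt (show (0 : ℝ) ≤ 1 + y ^ 2 by positivity)]
  field_simp

theorem radY_smul_vecY (Xα ξ : ℝ × ℝ → E4) (x y : ℝ) :
    radY x • vecY Xα ξ x y = (B2 x ^ 2 + C2 x ^ 2)⁻¹ •
      (B2 x • ξ (x, y) + C2 x • Xα (x, y)) := by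
  rw [radY, vecY, smul_smul, ← mul_inv, Real.mul_self_sqrt (B2_sq_add_C2_sq_pos x).le]

section Curves

variable {f φ Xα Xβ ξ : ℝ × ℝ → E4}

theorem IsCurvatureSurface.normalX_eq (hf : IsCurvatureSurface f φ Xα Xβ ξ) {x : ℝ} (hx : 0 < x)
    (y : ℝ) : y • Xβ (x, y) - φ (x, y) = y • Xβ (1, y) - φ (1, y) := by
  refine eq_one_of_hasDerivAt_zero (g := fun x => y • Xβ (x, y) - φ (x, y)) (fun s hs => ?_) hx
  have E := hf.frameEquationsAt (p := (s, y)) hs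
  refine (((hasDerivAt_dx hf.analytic_Xβ hs y).const_smul y).sub
    (hasDerivAt_dx hf.analytic_φ hs y)).congr_deriv ?_
  rw [E.dx_Xβ, E.dx_φ]
  match_scalars
  ring

theorem IsCurvatureSurface.centreX_eq (hf : IsCurvatureSurface f φ Xα Xβ ξ) {x : ℝ} (hx : 0 < x)
    (y : ℝ) : f (x, y) - radX y • vecX φ Xβ ξ x y = f (1, y) - radX y • vecX φ Xβ ξ 1 y := by
  refine eq_one_of_hasDerivAt_zero (g := fun x => f (x, y) - radX y • vecX φ Xβ ξ x y)
    (fun s hs => ?_) hx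
  have E := hf.frameEquationsAt (p := (s, y)) hs
  simp only [radX_smul_vecX]
  refine ((hasDerivAt_dx hf.analytic hs y).sub
    ((((hasDerivAt_dx hf.analytic_Xβ hs y).sub
      ((hasDerivAt_dx hf.analytic_ξ hs y).const_smul (2 * (1 + y ^ 2)))).add
      ((hasDerivAt_dx hf.analytic_φ hs y).const_smul y)).const_smul
        (2 * √5 * (1 + y ^ 2))⁻¹)).congr_deriv ?_
  rw [E.dx_f, E.dx_Xβ, E.dx_ξ, E.dx_φ]
  have h5 : √5 ≠ 0 := by positivity
  have hh := (hFun_pos s y).ne'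
  have hy : 1 + y ^ 2 ≠ 0 := by positivity
  match_scalars
  field_simp
  ring

theorem IsCurvatureSurface.normalY_eq (hf : IsCurvatureSurface f φ Xα Xβ ξ) {x : ℝ} (hx : 0 < x)
    (y : ℝ) : -(B2 x) • Xα (x, y) + C2 x • ξ (x, y) =
      -(B2 x) • Xα (x, 0) + C2 x • ξ (x, 0) := by
  refine eq_zero_of_hasDerivAt_zero (g := fun y => -(B2 x) • Xα (x, y) + C2 x • ξ (x, y))
    (fun s => ?_) y
  have E := hf.frameEquationsAt (p := (x, s)) hx
  refine (((hasDerivAt_dy hf.analytic_Xα hx s).const_smul (-(B2 x))).add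
    ((hasDerivAt_dy hf.analytic_ξ hx s).const_smul (C2 x))).congr_deriv ?_
  rw [E.dy_Xα, E.dy_ξ]
  match_scalars
  ring

theorem IsCurvatureSurface.centreY_eq (hf : IsCurvatureSurface f φ Xα Xβ ξ) {x : ℝ} (hx : 0 < x)
    (y : ℝ) : f (x, y) - radY x • vecY Xα ξ x y = f (x, 0) - radY x • vecY Xα ξ x 0 := by
  refine eq_zero_of_hasDerivAt_zero (g := fun y => f (x, y) - radY x • vecY Xα ξ x y)
    (fun s => ?_) y
  have E := hf.frameEquationsAt (p := (x, s)) hx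
  simp only [radY_smul_vecY]
  refine ((hasDerivAt_dy hf.analytic hx s).sub
    ((((hasDerivAt_dy hf.analytic_ξ hx s).const_smul (B2 x)).add
      ((hasDerivAt_dy hf.analytic_Xα hx s).const_smul (C2 x))).const_smul
        (B2 x ^ 2 + C2 x ^ 2)⁻¹)).congr_deriv ?_
  rw [E.dy_f, E.dy_Xα, E.dy_ξ]
  have hB := (B2_sq_add_C2_sq_pos x).ne'
  match_scalars
  field_simp
  ring

/-- Two curvature surfaces with the same frame field differ by a translation. -/
theorem IsCurvatureSurface.exists_eq_add (hf : IsCurvatureSurface f φ Xα Xβ ξ)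
    {g : ℝ × ℝ → E4} (hg : IsCurvatureSurface g φ Xα Xβ ξ) :
    ∃ c, ∀ x y, 0 < x → g (x, y) = f (x, y) + c := by
  refine ⟨g (1, 0) - f (1, 0), fun x y hx => ?_⟩
  have h1 := eq_zero_of_hasDerivAt_zero (g := fun y => g (x, y) - f (x, y)) (fun s => by
    refine ((hasDerivAt_dy hg.analytic hx s).sub (hasDerivAt_dy hf.analytic hx s)).congr_deriv ?_
    rw [(hf.frameEquationsAt (p := (x, s)) hx).dy_f, (hg.frameEquationsAt (p := (x, s)) hx).dy_f,
      sub_self]) y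
  have h2 := eq_one_of_hasDerivAt_zero (g := fun x => g (x, 0) - f (x, 0)) (fun s hs => by
    refine ((hasDerivAt_dx hg.analytic hs 0).sub (hasDerivAt_dx hf.analytic hs 0)).congr_deriv ?_
    rw [(hf.frameEquationsAt (p := (s, 0)) hs).dx_f, (hg.frameEquationsAt (p := (s, 0)) hs).dx_f,
      sub_self]) hx
  rw [← h2, ← h1]
  abel

/-! ### Norms and orthogonality in the orthonormal frame -/

theorem FrameEquationsAt.inner_normalX {x y : ℝ} (E : FrameEquationsAt f φ Xα Xβ ξ (x, y)) :
    inner ℝ (y • Xβ (x, y) - φ (x, y)) (y • Xβ (x, y) - φ (x, y)) = 1 + y ^ 2 := by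
  simp only [inner_sub_left, inner_sub_right, real_inner_smul_left, real_inner_smul_right,
    real_inner_comm (φ (x, y)) (Xβ (x, y)), E.φ_φ, E.β_β, E.φ_β]
  ring

theorem FrameEquationsAt.inner_vecX {x y : ℝ} (E : FrameEquationsAt f φ Xα Xβ ξ (x, y)) :
    inner ℝ (Xβ (x, y) - (2 * (1 + y ^ 2)) • ξ (x, y) + y • φ (x, y))
      (Xβ (x, y) - (2 * (1 + y ^ 2)) • ξ (x, y) + y • φ (x, y)) =
      (1 + y ^ 2) * (5 + 4 * y ^ 2) := by
  simp only [inner_add_left, inner_add_right, inner_sub_left, inner_sub_right,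
    real_inner_smul_left, real_inner_smul_right, real_inner_comm (φ (x, y)) (Xβ (x, y)),
    real_inner_comm (φ (x, y)) (ξ (x, y)), real_inner_comm (Xβ (x, y)) (ξ (x, y)),
    E.φ_φ, E.β_β, E.ξ_ξ, E.φ_β, E.φ_ξ, E.β_ξ]
  ring

theorem FrameEquationsAt.inner_normalX_vecX {x y : ℝ} (E : FrameEquationsAt f φ Xα Xβ ξ (x, y)) :
    inner ℝ (y • Xβ (x, y) - φ (x, y))
      (Xβ (x, y) - (2 * (1 + y ^ 2)) • ξ (x, y) + y • φ (x, y)) = 0 := by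
  simp only [inner_add_right, inner_sub_left, inner_sub_right,
    real_inner_smul_left, real_inner_smul_right, real_inner_comm (φ (x, y)) (Xβ (x, y)),
    E.φ_φ, E.β_β, E.φ_β, E.φ_ξ, E.β_ξ]
  ring

theorem FrameEquationsAt.inner_normalY {x y : ℝ} (E : FrameEquationsAt f φ Xα Xβ ξ (x, y)) :
    inner ℝ (-(B2 x) • Xα (x, y) + C2 x • ξ (x, y)) (-(B2 x) • Xα (x, y) + C2 x • ξ (x, y)) =
      B2 x ^ 2 + C2 x ^ 2 := by
  simp only [inner_add_left, inner_add_right, real_inner_smul_left, real_inner_smul_right,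
    real_inner_comm (Xα (x, y)) (ξ (x, y)), E.α_α, E.ξ_ξ, E.α_ξ]
  ring

theorem FrameEquationsAt.inner_vecY {x y : ℝ} (E : FrameEquationsAt f φ Xα Xβ ξ (x, y)) :
    inner ℝ (B2 x • ξ (x, y) + C2 x • Xα (x, y)) (B2 x • ξ (x, y) + C2 x • Xα (x, y)) =
      B2 x ^ 2 + C2 x ^ 2 := by
  simp only [inner_add_left, inner_add_right, real_inner_smul_left, real_inner_smul_right,
    real_inner_comm (Xα (x, y)) (ξ (x, y)), E.α_α, E.ξ_ξ, E.α_ξ]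
  ring

theorem FrameEquationsAt.inner_normalY_vecY {x y : ℝ} (E : FrameEquationsAt f φ Xα Xβ ξ (x, y)) :
    inner ℝ (-(B2 x) • Xα (x, y) + C2 x • ξ (x, y)) (B2 x • ξ (x, y) + C2 x • Xα (x, y)) = 0 := by
  simp only [inner_add_left, inner_add_right, real_inner_smul_left, real_inner_smul_right,
    real_inner_comm (Xα (x, y)) (ξ (x, y)), E.α_α, E.ξ_ξ, E.α_ξ]
  ring

theorem IsCurvatureSurface.analyticAt_centreX (hf : IsCurvatureSurface f φ Xα Xβ ξ) (y : ℝ) :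
    AnalyticAt ℝ (fun y => f (1, y) - radX y • vecX φ Xβ ξ 1 y) y := by
  have h0 : 2 * √5 * (1 + y ^ 2) ≠ 0 := by positivity
  have h1 : AnalyticAt ℝ (fun y : ℝ => (2 * √5 * (1 + y ^ 2))⁻¹) y := by
    fun_prop (disch := exact h0)
  have h2 : AnalyticAt ℝ (fun y : ℝ => 2 * (1 + y ^ 2)) y := by fun_prop
  simp only [radX_smul_vecX]
  exact (analyticAt_curveY hf.analytic one_pos y).fun_sub
    (h1.fun_smul (((analyticAt_curveY hf.analytic_Xβ one_pos y).fun_sub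
      (h2.fun_smul (analyticAt_curveY hf.analytic_ξ one_pos y))).fun_add
      (analyticAt_id.fun_smul (analyticAt_curveY hf.analytic_φ one_pos y))))

theorem analyticAt_inv_sqrt {g : ℝ → ℝ} {x : ℝ} (hg : AnalyticAt ℝ g x) (h0 : 0 < g x) :
    AnalyticAt ℝ (fun s => (√(g s))⁻¹) x :=
  (hg.contDiffAt.sqrt h0.ne').analyticAt.inv (Real.sqrt_pos.2 h0).ne'

end Curves

end CurvSurf

/-! ### The spheres containing the coordinate curves -/

theorem theorem2 (f φ Xα Xβ ξ : ℝ × ℝ → CurvSurf.E4)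
    (hf : CurvSurf.IsCurvatureSurface f φ Xα Xβ ξ) :
    -- x-curves
    (∃ u A : ℝ → CurvSurf.E4,
      AnalyticOnNhd ℝ u Set.univ ∧ AnalyticOnNhd ℝ A Set.univ ∧
      (∀ x y : ℝ, 0 < x →
        ‖u y‖ = 1 ∧
        u y = (√(1 + y ^ 2))⁻¹ • (y • Xβ (x, y) - φ (x, y)) ∧
        ‖CurvSurf.vecX φ Xβ ξ x y‖ = 1 ∧
        f (x, y) = CurvSurf.radX y • CurvSurf.vecX φ Xβ ξ x y + A y ∧
        f (x, y) ∈ CurvSurf.sphereIn (u y) (A y) (CurvSurf.radX y)) ∧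
      -- for the given frame field, `A` is unique up to a translation
      (∀ (g : ℝ × ℝ → CurvSurf.E4) (A' : ℝ → CurvSurf.E4),
        CurvSurf.IsCurvatureSurface g φ Xα Xβ ξ →
        (∀ x y : ℝ, 0 < x →
          g (x, y) = CurvSurf.radX y • CurvSurf.vecX φ Xβ ξ x y + A' y) →
        ∃ c : CurvSurf.E4, ∀ y, A' y = A y + c)) ∧
    -- positivity of `B₂² + C₂²`
    (∀ x : ℝ,
      CurvSurf.B2 x ^ 2 + CurvSurf.C2 x ^ 2 =
        CurvSurf.X0q x *
          (2 * CurvSurf.X0 x - x * CurvSurf.X0d x - CurvSurf.X0q x + √5) ∧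
      0 < CurvSurf.B2 x ^ 2 + CurvSurf.C2 x ^ 2) ∧
    -- y-curves
    (∃ v A : ℝ → CurvSurf.E4,
      AnalyticOnNhd ℝ v (Set.Ioi 0) ∧ AnalyticOnNhd ℝ A (Set.Ioi 0) ∧
      (∀ x y : ℝ, 0 < x →
        ‖v x‖ = 1 ∧
        v x = (√(CurvSurf.B2 x ^ 2 + CurvSurf.C2 x ^ 2))⁻¹ •
          (-(CurvSurf.B2 x) • Xα (x, y) + CurvSurf.C2 x • ξ (x, y)) ∧
        ‖CurvSurf.vecY Xα ξ x y‖ = 1 ∧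
        f (x, y) = CurvSurf.radY x • CurvSurf.vecY Xα ξ x y + A x ∧
        f (x, y) ∈ CurvSurf.sphereIn (v x) (A x) (CurvSurf.radY x)) ∧
      (∀ (g : ℝ × ℝ → CurvSurf.E4) (A' : ℝ → CurvSurf.E4),
        CurvSurf.IsCurvatureSurface g φ Xα Xβ ξ →
        (∀ x y : ℝ, 0 < x →
          g (x, y) = CurvSurf.radY x • CurvSurf.vecY Xα ξ x y + A' x) →
        ∃ c : CurvSurf.E4, ∀ x, 0 < x → A' x = A x + c)) := by
  open CurvSurf in
  refine ⟨?_, fun x => ⟨B2_sq_add_C2_sq x, B2_sq_add_C2_sq_pos x⟩, ?_⟩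
  -- Normal and centre do not depend on `x`, so evaluating them at `x = 1` defines functions of `y`
  -- alone, analytic because the frame is.
  · refine ⟨fun y => (√(1 + y ^ 2))⁻¹ • (y • Xβ (1, y) - φ (1, y)),
      fun y => f (1, y) - radX y • vecX φ Xβ ξ 1 y, ?_, ?_, ?_, ?_⟩
    · intro y _
      refine (analyticAt_inv_sqrt (by fun_prop) (by positivity)).smul ?_
      exact (analyticAt_id.smul (analyticAt_curveY hf.analytic_Xβ one_pos y)).sub
        (analyticAt_curveY hf.analytic_φ one_pos y)
    · exact fun y _ => hf.analyticAt_centreX y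
    · intro x y hx
      have E := hf.frameEquationsAt (p := (x, y)) hx
      have hA : f (x, y) = radX y • vecX φ Xβ ξ x y +
          (f (1, y) - radX y • vecX φ Xβ ξ 1 y) := by
        rw [← hf.centreX_eq hx y]; abel
      have hv : ‖vecX φ Xβ ξ x y‖ = 1 := norm_inv_sqrt_smul (by positivity) E.inner_vecX
      -- Moving the base point from `1` back to `x` turns the formula for the normal into a trivial
      -- identity.
      simp only [← hf.normalX_eq hx y]
      refine ⟨norm_inv_sqrt_smul (by positivity) E.inner_normalX, trivial, hv, hA,
        mem_sphereIn (by unfold radX; positivity) hv ?_ hA⟩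
      rw [vecX, inner_smul_left, inner_smul_right, E.inner_normalX_vecX, mul_zero, mul_zero]
    · intro g A' hg hgA
      obtain ⟨c, hc⟩ := hf.exists_eq_add hg
      refine ⟨c, fun y => ?_⟩
      have h := hgA 1 y one_pos
      rw [hc 1 y one_pos] at h
      rw [eq_sub_of_add_eq' h.symm]
      module
  -- Here the base point is `y = 0`; it lies in the singular set, but the frame is analytic there
  -- too.
  · refine ⟨fun x => (√(B2 x ^ 2 + C2 x ^ 2))⁻¹ • (-(B2 x) • Xα (x, 0) + C2 x • ξ (x, 0)),
      fun x => f (x, 0) - radY x • vecY Xα ξ x 0, ?_, ?_, ?_, ?_⟩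
    · intro x hx
      have hB := contDiff_B2.contDiffAt.analyticAt (x := x)
      have hC := contDiff_C2.contDiffAt.analyticAt (x := x)
      exact (analyticAt_inv_sqrt ((hB.pow 2).add (hC.pow 2)) (B2_sq_add_C2_sq_pos x)).smul
        ((hB.neg.smul (analyticAt_curveX hf.analytic_Xα hx 0)).add
          (hC.smul (analyticAt_curveX hf.analytic_ξ hx 0)))
    · intro x hx
      have hB := contDiff_B2.contDiffAt.analyticAt (x := x)
      have hC := contDiff_C2.contDiffAt.analyticAt (x := x)
      simp only [radY_smul_vecY]
      exact (analyticAt_curveX hf.analytic hx 0).sub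
        ((((hB.pow 2).add (hC.pow 2)).inv (B2_sq_add_C2_sq_pos x).ne').smul
          ((hB.smul (analyticAt_curveX hf.analytic_ξ hx 0)).add
            (hC.smul (analyticAt_curveX hf.analytic_Xα hx 0))))
    · intro x y hx
      have E := hf.frameEquationsAt (p := (x, y)) hx
      have hA : f (x, y) = radY x • vecY Xα ξ x y +
          (f (x, 0) - radY x • vecY Xα ξ x 0) := by
        rw [← hf.centreY_eq hx y]; abel
      have hv : ‖vecY Xα ξ x y‖ = 1 := norm_inv_sqrt_smul (B2_sq_add_C2_sq_pos x) E.inner_vecY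
      simp only [← hf.normalY_eq hx y]
      refine ⟨norm_inv_sqrt_smul (B2_sq_add_C2_sq_pos x) E.inner_normalY, trivial, hv, hA,
        mem_sphereIn (by unfold radY; positivity) hv ?_ hA⟩
      rw [vecY, inner_smul_left, inner_smul_right, E.inner_normalY_vecY, mul_zero, mul_zero]
    · intro g A' hg hgA
      obtain ⟨c, hc⟩ := hf.exists_eq_add hg
      refine ⟨c, fun x hx => ?_⟩
      have h := hgA x 0 hx
      rw [hc x 0 hx] at h
      rw [eq_sub_of_add_eq' h.symm]
      module
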